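/- Let $\mathcal H_+$ and $\mathcal H_-$ be complex Hilbert spaces, let $A$ and $D$ be (possibly unbounded) self-adjoint operators in $\mathcal H_+$ and $\mathcal H_-$, respectively, let $B:\mathcal H_-\to\mathcal H_+$ be a bounded linear operator, and consider in $\mathcal H_+\oplus\mathcal H_-$ the block operator matrix $$S=\begin{pmatrix}A&B\\-B^*&D\end{pmatrix},\qquad \operatorname{dom}S=\operatorname{dom}A\oplus\operatorname{dom}D.$$ For a closed set $M\subseteq\mathbb R$ let $C^+(M)$ be the set of all continuous functions $f:M\to\mathbb R$ such that $f(t)>0$ for all $t\in M$, $\sup_{t\in M}f(t)<\infty$ and $\inf_{t\in M,\,|t|\ge1}|t|f(t)>0$ (with $\inf\emptyset=+\infty$). For a self-adjoint operator $T$ in a Hilbert space $\mathcal H_1$ with spectral measure $E_T$ and a bounded operator $V$ from a Hilbert space $\mathcal H_2$ to $\mathcal H_1$, let $\sigma_V(T)\subseteq\mathbb R$ be the support of the positive operator-valued measure $V^*E_T(\cdot)V$, and for bounded continuous $f$ on $\sigma(T)$ let $f(T)=\int_{\sigma(T)}f\,dE_T$. Let $\mathcal B_r(a)=\{z\in\mathbb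 C:|z-a|\le r\}$ be the closed disc. Then, for any $f\in C^+(\sigma(A))$ and $g\in C^+(\sigma(D))$, $$\sigma(S)\setminus\mathbb R\;\subseteq\;\Biggl(\,\bigcup_{t\in\sigma_B(A)}\mathcal B_{\|f(A)B\|/f(t)}(t)\Biggr)\cap\Biggl(\,\bigcup_{s\in\sigma_{B^*}(D)}\mathcal B_{\|g(D)B^*\|/g(s)}(s)\Biggr).$$ -/

import Mathlib

open scoped InnerProductSpace

section OperatorSpectrum

/-- The resolvent set of a (possibly unbounded) linear operator `T` in `H`: those `z` for which
`T - z : dom T → H` is a bijection with bounded everywhere defined inverse `R`. -/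
def LinearPMap.resolventPoints {H : Type*} [NormedAddCommGroup H] [NormedSpace ℂ H]
    (T : H →ₗ.[ℂ] H) : Set ℂ :=
  {z | ∃ R : H →L[ℂ] H,
    (∀ x : T.domain, R (T x - z • (x : H)) = x) ∧
    (∀ y : H, ∃ h : R y ∈ T.domain, T ⟨R y, h⟩ - z • R y = y)}

/-- The spectrum of a (possibly unbounded) linear operator. -/
def LinearPMap.opSpectrum {H : Type*} [NormedAddCommGroup H] [NormedSpace ℂ H]
    (T : H →ₗ.[ℂ] H) : Set ℂ :=
  (T.resolventPoints)ᶜ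

/-- The set of real points of the spectrum; for self-adjoint `T` this is the whole spectrum,
regarded as a subset of `ℝ`. -/
def LinearPMap.realSpectrum {H : Type*} [NormedAddCommGroup H] [NormedSpace ℂ H]
    (T : H →ₗ.[ℂ] H) : Set ℝ :=
  {t | (t : ℂ) ∈ T.opSpectrum}

end OperatorSpectrum

section BlockMatrix

/-- The block operator matrix `[[A, B], [C, D]]` in the Hilbert space direct sum of `H₁` and `H₂`
with unbounded diagonal entries `A`, `D`, bounded off-diagonal entries `B`, `C`, and domain
`dom A ⊕ dom D`. -/
noncomputable def blockOperator {H₁ H₂ : Type*}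
    [NormedAddCommGroup H₁] [InnerProductSpace ℂ H₁]
    [NormedAddCommGroup H₂] [InnerProductSpace ℂ H₂]
    (A : H₁ →ₗ.[ℂ] H₁) (B : H₂ →L[ℂ] H₁) (C : H₁ →L[ℂ] H₂) (D : H₂ →ₗ.[ℂ] H₂) :
    WithLp 2 (H₁ × H₂) →ₗ.[ℂ] WithLp 2 (H₁ × H₂) where
  domain := (A.domain.prod D.domain).comap
    (WithLp.linearEquiv 2 ℂ (H₁ × H₂)).toLinearMap
  toFun :=
    { toFun := fun x => WithLp.toLp 2
        (A ⟨(x : WithLp 2 (H₁ × H₂)).fst, x.2.1⟩ + B (x : WithLp 2 (H₁ × H₂)).snd,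
         C (x : WithLp 2 (H₁ × H₂)).fst + D ⟨(x : WithLp 2 (H₁ × H₂)).snd, x.2.2⟩)
      map_add' := by
        intro x y
        have h1 : A ⟨((x + y : _) : WithLp 2 (H₁ × H₂)).fst, (x + y).2.1⟩
            = A ⟨(x : WithLp 2 (H₁ × H₂)).fst, x.2.1⟩
              + A ⟨(y : WithLp 2 (H₁ × H₂)).fst, y.2.1⟩ := by
          rw [← A.map_add]; rfl
        have h2 : D ⟨((x + y : _) : WithLp 2 (H₁ × H₂)).snd, (x + y).2.2⟩
            = D ⟨(x : WithLp 2 (H₁ × H₂)).snd, x.2.2⟩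
              + D ⟨(y : WithLp 2 (H₁ × H₂)).snd, y.2.2⟩ := by
          rw [← D.map_add]; rfl
        rw [h1, h2, ← WithLp.toLp_add]
        congr 1
        ext <;> simp <;> abel
      map_smul' := by
        intro c x
        have h1 : A ⟨((c • x : _) : WithLp 2 (H₁ × H₂)).fst, (c • x).2.1⟩
            = c • A ⟨(x : WithLp 2 (H₁ × H₂)).fst, x.2.1⟩ := by
          rw [← A.map_smul]; rfl
        have h2 : D ⟨((c • x : _) : WithLp 2 (H₁ × H₂)).snd, (c • x).2.2⟩
            = c • D ⟨(x : WithLp 2 (H₁ × H₂)).snd, x.2.2⟩ := by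
          rw [← D.map_smul]; rfl
        rw [h1, h2, RingHom.id_apply, ← WithLp.toLp_smul]
        congr 1
        ext <;> simp }

end BlockMatrix

section SpectralMeasure

/-- A (normalized) projection-valued Borel measure on `ℝ` acting in the Hilbert space `H`:
orthogonal projections `E s` for Borel sets `s`, with `E ℝ = 1`, countably additive in the strong
operator topology. The value on non-Borel sets is `0` by convention. -/
structure ProjectionMeasure (H : Type*) [NormedAddCommGroup H] [InnerProductSpace ℂ H]
    [CompleteSpace H] where
  proj : Set ℝ → H →L[ℂ] H
  proj_of_not_measurable : ∀ s, ¬ MeasurableSet s → proj s = 0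
  isStarProjection : ∀ s, MeasurableSet s → IsStarProjection (proj s)
  proj_univ : proj Set.univ = 1
  hasSum_iUnion : ∀ s : ℕ → Set ℝ, (∀ i, MeasurableSet (s i)) →
    Pairwise (Function.onFun Disjoint s) →
    ∀ x, HasSum (fun i => proj (s i) x) (proj (⋃ i, s i) x)

namespace ProjectionMeasure

variable {H : Type*} [NormedAddCommGroup H] [InnerProductSpace ℂ H] [CompleteSpace H]

theorem proj_empty (E : ProjectionMeasure H) : E.proj ∅ = 0 := by
  ext x
  have h := E.hasSum_iUnion (fun _ => ∅) (fun _ => MeasurableSet.empty)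
    (fun _ _ _ => by simp [Function.onFun]) x
  have h0 := h.summable.tendsto_atTop_zero
  exact tendsto_nhds_unique tendsto_const_nhds h0

theorem norm_sq_eq (E : ProjectionMeasure H) {s : Set ℝ} (hs : MeasurableSet s) (x : H) :
    ‖E.proj s x‖ ^ 2 = (⟪x, E.proj s x⟫_ℂ).re := by
  have hp := E.isStarProjection s hs
  have h2 : E.proj s (E.proj s x) = E.proj s x := by
    have := congrArg (fun F : H →L[ℂ] H => F x) hp.isIdempotentElem.eq
    simpa using this
  have h3 := (ContinuousLinearMap.isSelfAdjoint_iff_isSymmetric.mp hp.isSelfAdjoint) x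
    (E.proj s x)
  have h4 : ⟪E.proj s x, E.proj s x⟫_ℂ = ⟪x, E.proj s x⟫_ℂ := by
    simpa [h2] using h3
  rw [← h4, inner_self_eq_norm_sq_to_K]
  norm_cast

/-- The finite positive Borel measure `s ↦ ‖E(s) x‖² = ⟨E(s) x, x⟩`. -/
noncomputable def scalarMeasure (E : ProjectionMeasure H) (x : H) : MeasureTheory.Measure ℝ :=
  MeasureTheory.Measure.ofMeasurable (fun s _ => ENNReal.ofReal (‖E.proj s x‖ ^ 2))
    (by simp [E.proj_empty])
    (by
      intro s hs hd
      have h := E.hasSum_iUnion s hs hd x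
      have h' := (Complex.reCLM.hasSum ((innerSL ℂ x).hasSum h))
      have h'' : HasSum (fun i => ‖E.proj (s i) x‖ ^ 2) (‖E.proj (⋃ i, s i) x‖ ^ 2) := by
        rw [E.norm_sq_eq (MeasurableSet.iUnion hs)]
        simp_rw [fun i => E.norm_sq_eq (hs i) x]
        simpa using h'
      rw [← h''.tsum_eq, ENNReal.ofReal_tsum_of_nonneg (fun _ => by positivity) h''.summable])

/-- The unit mass at `0`; it only serves to show that projection-valued measures exist. -/
instance : Nonempty (ProjectionMeasure H) := by
  classical
  refine ⟨⟨fun s => if MeasurableSet s ∧ (0 : ℝ) ∈ s then 1 else 0, ?_, ?_, by simp, ?_⟩⟩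
  · intro s hs; simp [hs]
  · intro s hs
    split_ifs
    · exact IsStarProjection.one _
    · exact IsStarProjection.zero _
  · intro s hs hd x
    by_cases h : ∃ i, (0 : ℝ) ∈ s i
    · obtain ⟨i, hi⟩ := h
      have hU : (0 : ℝ) ∈ ⋃ i, s i := Set.mem_iUnion.2 ⟨i, hi⟩
      have := hasSum_single (f := fun j => (if MeasurableSet (s j) ∧ (0 : ℝ) ∈ s j
        then (1 : H →L[ℂ] H) else 0) x) i (fun j hj => by
          have : (0 : ℝ) ∉ s j := fun hj' => Set.disjoint_left.1 (hd hj) hj' hi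
          simp [this])
      simpa [hs, hi, hU, MeasurableSet.iUnion hs, -Set.mem_iUnion] using this
    · have hU : (0 : ℝ) ∉ ⋃ i, s i := fun hU => h (Set.mem_iUnion.1 hU)
      have h' : ∀ i, (0 : ℝ) ∉ s i := fun i hi => h ⟨i, hi⟩
      simp only [h', hU, and_false, if_false, zero_apply]
      exact hasSum_zero

/-- `E` is the spectral measure of `T`, that is, `T = ∫ t dE(t)`: the domain of `T` consists of
those `x` with `∫ t² d‖E(t)x‖² < ∞`, and `⟨x, T x⟩ = ∫ t d‖E(t)x‖²` for these `x`
(by polarization the quadratic form determines `T` on its domain). -/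
def IsSpectralMeasureOf (E : ProjectionMeasure H) (T : H →ₗ.[ℂ] H) : Prop :=
  (∀ x : H, x ∈ T.domain ↔ ∫⁻ t, ENNReal.ofReal (t ^ 2) ∂(E.scalarMeasure x) < ⊤) ∧
  (∀ x : T.domain, ⟪(x : H), T x⟫_ℂ = ((∫ t, t ∂(E.scalarMeasure (x : H)) : ℝ) : ℂ))

/-- The support of the positive operator-valued measure `s ↦ V* E(s) V`: the points all of whose
open neighbourhoods have non-zero measure. -/
def compressedSupport {K : Type*} [NormedAddCommGroup K] [InnerProductSpace ℂ K]
    [CompleteSpace K] (E : ProjectionMeasure H) (V : K →L[ℂ] H) : Set ℝ :=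
  {t | ∀ U : Set ℝ, IsOpen U → t ∈ U →
    (ContinuousLinearMap.adjoint V).comp ((E.proj U).comp V) ≠ 0}

end ProjectionMeasure

namespace LinearPMap

variable {H : Type*} [NormedAddCommGroup H] [InnerProductSpace ℂ H] [CompleteSpace H]

/-- The spectral measure `E_T` of a self-adjoint operator `T`, i.e. the unique projection-valued
measure with `T = ∫ t dE_T(t)`. -/
noncomputable def spectralMeasure (T : H →ₗ.[ℂ] H) : ProjectionMeasure H :=
  Classical.epsilon fun E => E.IsSpectralMeasureOf T

/-- The operator `f(T) = ∫_{σ(T)} f dE_T`, for self-adjoint `T` and bounded continuous real `f` on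
the spectrum of `T`: the unique bounded operator `F` with `⟨x, F x⟩ = ∫_{σ(T)} f d‖E_T(t)x‖²` for
all `x`. Only the values of `f` on the spectrum matter. -/
noncomputable def functionOf (f : ℝ → ℝ) (T : H →ₗ.[ℂ] H) : H →L[ℂ] H :=
  Classical.epsilon fun F : H →L[ℂ] H => ∀ x : H,
    ⟪x, F x⟫_ℂ = ((∫ t in T.realSpectrum, f t ∂(T.spectralMeasure.scalarMeasure x) : ℝ) : ℂ)

/-- The local spectrum `σ_V(T)`: the support of the measure `V* E_T(·) V`. -/
noncomputable def localSpectrum {K : Type*} [NormedAddCommGroup K] [InnerProductSpace ℂ K]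
    [CompleteSpace K] (V : K →L[ℂ] H) (T : H →ₗ.[ℂ] H) : Set ℝ :=
  T.spectralMeasure.compressedSupport V

end LinearPMap

end SpectralMeasure

section AdmissibleFunctions

/-- The class `C⁺(M)`: `f` is continuous and positive on `M`, bounded above on `M`, and the infimum
of `|t| f(t)` over `t ∈ M` with `|t| ≥ 1` is positive (`+∞` if there is no such `t`). -/
def CPlus (M : Set ℝ) : Set (ℝ → ℝ) :=
  {f | ContinuousOn f M ∧ (∀ t ∈ M, 0 < f t) ∧ BddAbove (f '' M) ∧
    ∃ c : ℝ, 0 < c ∧ ∀ t ∈ M, 1 ≤ |t| → c ≤ |t| * f t}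

end AdmissibleFunctions

/-!
Fix a non-real `z` outside the first union of discs, so that `‖f(A) B‖ < f(t) |t - z|` for all `t` in
the local spectrum of `A` with respect to `B`. With `μ` the scalar spectral measure of `B x`,

`‖f(A) B‖² ‖(A - z)⁻¹ B x‖² = ‖f(A) B‖² ∫ |t - z|⁻² dμ ≤ ∫ f² dμ = ‖f(A) B x‖² ≤ ‖f(A) B‖² ‖x‖²`,

and a compactness argument improves this to `‖(A - z)⁻¹ B x‖² ≤ q ‖x‖²` with `q < 1`
(`LinearPMap.exists_norm_resolvent_comp_lt_one`). Then the imaginary part of the quadratic form of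
the Schur complement `D - z + B* (A - z)⁻¹ B`, namely `Im z (‖(A - z)⁻¹ B y‖² - ‖y‖²)`, is definite,
and a self-adjoint operator perturbed by a bounded one with this property is boundedly invertible
(`LinearPMap.exists_inverse_add`). Hence `z` is in the resolvent set of the block operator
(`blockOperator_mem_resolventPoints_of_left`). The second union is treated by exchanging the
components.

The spectral measure and `f(T)` are defined by choice, so the spectral theorem for unbounded
self-adjoint operators is needed to know that the chosen objects have their defining properties
(`LinearPMap.exists_isSpectralMeasureOf`). It comes from the continuous functional calculus of the
bounded normal operator `(T - i)⁻¹`, which the Riesz–Markov–Kakutani theorem and `L²` density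
(`exists_operator_of_dense`) extend to Borel functions. The same density lemma, applied to simple
functions, gives the bounded Borel functional calculus of an arbitrary projection-valued measure
(`ProjectionMeasure.integral`), in which `(T - z)⁻¹` is the integral of `(t - z)⁻¹`
(`ProjectionMeasure.IsSpectralMeasureOf.apply_integral_inv_sub`).
-/

/-! ### Resolvents and bounded perturbations of self-adjoint operators -/

section Perturbation

/-- The operator `R` is the resolvent `(T - z)⁻¹`. -/
def LinearPMap.IsResolvent {H : Type*} [NormedAddCommGroup H] [NormedSpace ℂ H]
    (T : H →ₗ.[ℂ] H) (z : ℂ) (R : H →L[ℂ] H) : Prop :=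
  (∀ x : T.domain, R (T x - z • (x : H)) = x) ∧
    ∀ y : H, ∃ h : R y ∈ T.domain, T ⟨R y, h⟩ - z • R y = y

/-- The first resolvent identity. -/
theorem LinearPMap.IsResolvent.sub_eq {H : Type*} [NormedAddCommGroup H] [NormedSpace ℂ H]
    {T : H →ₗ.[ℂ] H} {z w : ℂ} {R S : H →L[ℂ] H}
    (hR : T.IsResolvent z R) (hS : T.IsResolvent w S) :
    R - S = (z - w) • (R * S) := by
  ext u
  obtain ⟨h, e⟩ := hS.2 u
  have h1 := hR.1 ⟨S u, h⟩
  have h2 : T ⟨S u, h⟩ - z • S u = u - (z - w) • S u := by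
    rw [sub_smul, eq_add_of_sub_eq e]
    abel
  simp only at h1
  rw [h2, _root_.map_sub, _root_.map_smul] at h1
  rw [_root_.sub_apply, _root_.smul_apply, mul_apply_eq_comp, sub_eq_iff_eq_add]
  exact sub_eq_iff_eq_add'.1 h1

variable {H : Type*} [NormedAddCommGroup H] [InnerProductSpace ℂ H] [CompleteSpace H]

theorem LinearPMap.inner_apply_eq_of_isSelfAdjoint {T : H →ₗ.[ℂ] H} (hT : IsSelfAdjoint T)
    (x y : T.domain) : ⟪T x, (y : H)⟫_ℂ = ⟪(x : H), T y⟫_ℂ := by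
  have h := LinearPMap.adjoint_isFormalAdjoint hT.dense_domain
  rw [LinearPMap.isSelfAdjoint_def.1 hT] at h
  exact h x y

theorem LinearPMap.im_inner_self_eq_zero {T : H →ₗ.[ℂ] H} (hT : IsSelfAdjoint T)
    (x : T.domain) : (⟪(x : H), T x⟫_ℂ).im = 0 := by
  have h := inner_apply_eq_of_isSelfAdjoint hT x x
  rw [← inner_conj_symm] at h
  exact Complex.conj_eq_iff_im.1 h

theorem LinearPMap.mem_domain_of_isSelfAdjoint {T : H →ₗ.[ℂ] H} (hT : IsSelfAdjoint T)
    {w v : H} (h : ∀ x : T.domain, ⟪v, (x : H)⟫_ℂ = ⟪w, T x⟫_ℂ) :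
    ∃ hw : w ∈ T.domain, T ⟨w, hw⟩ = v := by
  have h1 : (w, v) ∈ T.adjoint.graph := by
    have hw := LinearPMap.mem_adjoint_domain_of_exists (T := T) w ⟨v, h⟩
    rw [LinearPMap.mem_graph_iff]
    exact ⟨⟨w, hw⟩, rfl, LinearPMap.adjoint_apply_eq hT.dense_domain _ h⟩
  rw [LinearPMap.isSelfAdjoint_def.1 hT, LinearPMap.mem_graph_iff] at h1
  obtain ⟨y, hy, hy'⟩ := h1
  subst hy
  exact ⟨y.2, hy'⟩

/-- If `T` is self-adjoint and the imaginary part of the quadratic form of the bounded operator `K`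
is bounded away from `0`, then `T + K` has a bounded inverse: the form bound makes `T + K` bounded
below, so its range is closed, and a vector `w` orthogonal to the range satisfies `T w = -K* w`,
whence `⟨w, K w⟩` is real and `w = 0`. -/
theorem LinearPMap.exists_inverse_add {T : H →ₗ.[ℂ] H} (hT : IsSelfAdjoint T) (K : H →L[ℂ] H)
    {ε : ℝ} (hε : 0 < ε) (hK : ∀ x, ε * ‖x‖ ^ 2 ≤ |(⟪x, K x⟫_ℂ).im|) :
    ∃ R : H →L[ℂ] H, (∀ x : T.domain, R (T x + K x) = x) ∧
      ∀ y, ∃ h : R y ∈ T.domain, T ⟨R y, h⟩ + K (R y) = y := by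
  let L : T.domain →ₗ[ℂ] H := T.toFun + K.toLinearMap ∘ₗ T.domain.subtype
  have hL : ∀ x : T.domain, L x = T x + K x := fun x => rfl
  have bound : ∀ x : T.domain, ε * ‖(x : H)‖ ≤ ‖L x‖ := by
    intro x
    by_cases hx : ‖(x : H)‖ = 0
    · simp [hx]
    have hx' : 0 < ‖(x : H)‖ := lt_of_le_of_ne (norm_nonneg _) (Ne.symm hx)
    have h1 : (⟪(x : H), L x⟫_ℂ).im = (⟪(x : H), K x⟫_ℂ).im := by
      rw [hL, inner_add_right, Complex.add_im, im_inner_self_eq_zero hT, zero_add]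
    have h2 := hK x
    rw [← h1] at h2
    have h3 := (h2.trans (Complex.abs_im_le_norm _)).trans (norm_inner_le_norm _ _)
    nlinarith
  have inj : Function.Injective L := by
    rw [injective_iff_map_eq_zero]
    intro x hx
    have := bound x
    rw [hx, norm_zero] at this
    have h0 : ‖(x : H)‖ ≤ 0 := by
      by_contra hc
      push Not at hc
      nlinarith [mul_pos hε hc]
    exact Subtype.ext (norm_le_zero_iff.1 h0)
  have closed : _root_.IsClosed (LinearMap.range L : Set H) := by
    refine isClosed_of_closure_subset fun y hy => ?_
    obtain ⟨u, hu, hlim⟩ := mem_closure_iff_seq_limit.1 hy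
    choose x hx using hu
    have hc : CauchySeq fun n => (x n : H) := by
      have huc := hlim.cauchySeq
      rw [Metric.cauchySeq_iff] at huc ⊢
      intro δ hδ
      obtain ⟨N, hN⟩ := huc (ε * δ) (mul_pos hε hδ)
      refine ⟨N, fun m hm n hn => ?_⟩
      have h := hN m hm n hn
      rw [dist_eq_norm, ← hx, ← hx, ← _root_.map_sub] at h
      have hb := bound (x m - x n)
      rw [dist_eq_norm]
      have : ε * ‖(x m : H) - x n‖ < ε * δ := by
        simpa using hb.trans_lt h
      exact lt_of_mul_lt_mul_left this hε.le
    obtain ⟨x0, hx0⟩ := cauchySeq_tendsto_of_complete hc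
    have hT' : Filter.Tendsto (fun n => T (x n)) Filter.atTop (nhds (y - K x0)) := by
      have : ∀ n, T (x n) = u n - K (x n) := fun n => by rw [← hx, hL, add_sub_cancel_right]
      simp_rw [this]
      exact hlim.sub ((K.continuous.tendsto x0).comp hx0)
    have hg := hT.isClosed.mem_of_tendsto (hx0.prodMk_nhds hT')
      (Filter.Eventually.of_forall fun n => T.mem_graph (x n))
    obtain ⟨x1, h1, h2⟩ := (LinearPMap.mem_graph_iff _).1 hg
    refine ⟨x1, ?_⟩
    rw [hL, h2, h1]
    simp
  have surj : LinearMap.range L = ⊤ := by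
    have hd : (LinearMap.range L)ᗮ = ⊥ := by
      rw [Submodule.eq_bot_iff]
      intro w hw
      have h : ∀ x : T.domain, ⟪-(ContinuousLinearMap.adjoint K w), (x : H)⟫_ℂ = ⟪w, T x⟫_ℂ := by
        intro x
        have h0 := (Submodule.mem_orthogonal' _ _).1 hw (L x) ⟨x, rfl⟩
        rw [hL, inner_add_right] at h0
        rw [inner_neg_left, ContinuousLinearMap.adjoint_inner_left]
        exact (eq_neg_of_add_eq_zero_left h0).symm
      obtain ⟨hw', hTw⟩ := mem_domain_of_isSelfAdjoint hT h
      have him := im_inner_self_eq_zero hT ⟨w, hw'⟩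
      rw [hTw, inner_neg_right, ContinuousLinearMap.adjoint_inner_right, ← inner_conj_symm] at him
      simp only [Complex.neg_im, Complex.conj_im, neg_neg] at him
      have h2 := hK w
      rw [him, abs_zero] at h2
      have : ‖w‖ ^ 2 ≤ 0 := by
        by_contra hc
        push Not at hc
        nlinarith [mul_pos hε hc]
      exact norm_eq_zero.1 (pow_eq_zero_iff two_ne_zero |>.1 (le_antisymm this (by positivity)))
    rw [← (Submodule.topologicalClosure_eq_top_iff).2 hd]
    exact closed.submodule_topologicalClosure_eq.symm
  let e := LinearEquiv.ofBijective L ⟨inj, LinearMap.range_eq_top.1 surj⟩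
  let R : H →L[ℂ] H := (T.domain.subtype ∘ₗ e.symm.toLinearMap).mkContinuous ε⁻¹ (by
    intro y
    have hb := bound (e.symm y)
    have : L (e.symm y) = y := e.apply_symm_apply y
    rw [this] at hb
    rw [inv_mul_eq_div, le_div_iff₀ hε, mul_comm]
    exact hb)
  refine ⟨R, fun x => ?_, fun y => ⟨(e.symm y).2, ?_⟩⟩
  · change ((e.symm (L x) : T.domain) : H) = x
    rw [show e.symm (L x) = x from e.symm_apply_apply x]
  · exact e.apply_symm_apply y

/-- The resolvent set of a self-adjoint operator contains all non-real numbers. -/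
theorem LinearPMap.mem_resolventPoints_of_im_ne_zero {T : H →ₗ.[ℂ] H} (hT : IsSelfAdjoint T)
    {z : ℂ} (hz : z.im ≠ 0) : z ∈ T.resolventPoints := by
  obtain ⟨R, h1, h2⟩ := exists_inverse_add hT (-(z • ContinuousLinearMap.id ℂ H))
    (abs_pos.2 hz) (by
      intro x
      have : (⟪x, (-(z • ContinuousLinearMap.id ℂ H)) x⟫_ℂ).im = - (z.im * ‖x‖ ^ 2) := by
        simp [inner_smul_right, inner_self_eq_norm_sq_to_K, ← Complex.ofReal_pow]
      rw [this, abs_neg, abs_mul, abs_of_nonneg (sq_nonneg ‖x‖)])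
  refine ⟨R, fun x => ?_, fun y => ?_⟩
  · have := h1 x
    simpa [← sub_eq_add_neg] using this
  · obtain ⟨h, h'⟩ := h2 y
    exact ⟨h, by simpa [← sub_eq_add_neg] using h'⟩

end Perturbation

/-! ### Block operator matrices and the Schur complement -/

section Schur

/-- A bounded inverse of `S - z`, given by its two components `X` and `Y`. -/
theorem blockOperator_mem_resolventPoints {H₁ H₂ : Type*}
    [NormedAddCommGroup H₁] [InnerProductSpace ℂ H₁]
    [NormedAddCommGroup H₂] [InnerProductSpace ℂ H₂] (A : H₁ →ₗ.[ℂ] H₁) (B : H₂ →L[ℂ] H₁) (C : H₁ →L[ℂ] H₂)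
    (D : H₂ →ₗ.[ℂ] H₂) (z : ℂ) (X : H₁ × H₂ →L[ℂ] H₁) (Y : H₁ × H₂ →L[ℂ] H₂)
    (hX : ∀ (x : A.domain) (y : D.domain),
      X (A x + B y - z • (x : H₁), C x + D y - z • (y : H₂)) = x)
    (hY : ∀ (x : A.domain) (y : D.domain),
      Y (A x + B y - z • (x : H₁), C x + D y - z • (y : H₂)) = y)
    (h : ∀ p, ∃ (h₁ : X p ∈ A.domain) (h₂ : Y p ∈ D.domain),
      A ⟨X p, h₁⟩ + B (Y p) - z • X p = p.1 ∧ C (X p) + D ⟨Y p, h₂⟩ - z • Y p = p.2) :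
    z ∈ (blockOperator A B C D).resolventPoints := by
  let e := WithLp.prodContinuousLinearEquiv 2 ℂ H₁ H₂
  refine ⟨(e.symm : H₁ × H₂ →L[ℂ] _) ∘L (X.prod Y) ∘L (e : _ →L[ℂ] H₁ × H₂), ?_, ?_⟩
  · intro x
    apply e.injective
    exact Prod.ext (hX ⟨_, x.2.1⟩ ⟨_, x.2.2⟩) (hY ⟨_, x.2.1⟩ ⟨_, x.2.2⟩)
  · intro y
    obtain ⟨h₁, h₂, h3, h4⟩ := h (e y)
    refine ⟨⟨h₁, h₂⟩, ?_⟩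
    apply e.injective
    exact Prod.ext h3 h4

variable {H₁ H₂ : Type*}
  [NormedAddCommGroup H₁] [InnerProductSpace ℂ H₁] [CompleteSpace H₁]
  [NormedAddCommGroup H₂] [InnerProductSpace ℂ H₂] [CompleteSpace H₂]

/-- The components of the resolvent of `[[A, B], [-B*, D]]`, when `(A - z)⁻¹ B` is a strict
contraction. The Schur complement is `D - z + B* (A - z)⁻¹ B`, and the imaginary part of its
quadratic form is `Im z * (‖(A - z)⁻¹ B y‖ ^ 2 - ‖y‖ ^ 2)`, which is definite. -/
theorem exists_schur_inverse {A : H₁ →ₗ.[ℂ] H₁} (hA : IsSelfAdjoint A) {D : H₂ →ₗ.[ℂ] H₂}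
    (hD : IsSelfAdjoint D) (B : H₂ →L[ℂ] H₁) {z : ℂ} (hz : z.im ≠ 0) {R : H₁ →L[ℂ] H₁}
    (hR : A.IsResolvent z R)
    {q : ℝ} (hq : q < 1) (hB : ∀ y, ‖R (B y)‖ ^ 2 ≤ q * ‖y‖ ^ 2) :
    ∃ (X : H₁ × H₂ →L[ℂ] H₁) (Y : H₁ × H₂ →L[ℂ] H₂),
      (∀ (x : A.domain) (y : D.domain),
        X (A x + B y - z • (x : H₁), -(ContinuousLinearMap.adjoint B x) + D y - z • (y : H₂)) = x) ∧
      (∀ (x : A.domain) (y : D.domain),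
        Y (A x + B y - z • (x : H₁), -(ContinuousLinearMap.adjoint B x) + D y - z • (y : H₂)) = y) ∧
      ∀ p, ∃ (h₁ : X p ∈ A.domain) (h₂ : Y p ∈ D.domain),
        A ⟨X p, h₁⟩ + B (Y p) - z • X p = p.1 ∧
        -(ContinuousLinearMap.adjoint B (X p)) + D ⟨Y p, h₂⟩ - z • Y p = p.2 := by
  obtain ⟨hR₁, hR₂⟩ := hR
  set C := ContinuousLinearMap.adjoint B with hC
  let K : H₂ →L[ℂ] H₂ := C ∘L R ∘L B - z • ContinuousLinearMap.id ℂ H₂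
  have hK : ∀ y, K y = C (R (B y)) - z • y := fun y => by simp [K]
  obtain ⟨M, hM₁, hM₂⟩ := LinearPMap.exists_inverse_add hD K
    (ε := |z.im| * (1 - q)) (mul_pos (abs_pos.2 hz) (by linarith)) (by
      intro y
      have h1 : (⟪y, K y⟫_ℂ).im = z.im * (‖R (B y)‖ ^ 2 - ‖y‖ ^ 2) := by
        obtain ⟨hw, hw'⟩ := hR₂ (B y)
        have h2 : (⟪B y, R (B y)⟫_ℂ).im = z.im * ‖R (B y)‖ ^ 2 := by
          generalize R (B y) = w at hw hw' ⊢
          rw [← hw', inner_sub_left, LinearPMap.inner_apply_eq_of_isSelfAdjoint hA ⟨w, hw⟩ ⟨w, hw⟩,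
            Complex.sub_im, LinearPMap.im_inner_self_eq_zero hA ⟨w, hw⟩, inner_smul_left,
            inner_self_eq_norm_sq_to_K]
          simp [← Complex.ofReal_pow]
        rw [hK, inner_sub_right, hC, ContinuousLinearMap.adjoint_inner_right, Complex.sub_im, h2,
          inner_smul_right, inner_self_eq_norm_sq_to_K]
        simp [← Complex.ofReal_pow]
        ring
      have h3 := hB y
      have h4 : |‖R (B y)‖ ^ 2 - ‖y‖ ^ 2| ≥ (1 - q) * ‖y‖ ^ 2 :=
        le_trans (by linarith) (neg_le_abs _)
      rw [h1, abs_mul, mul_assoc]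
      exact mul_le_mul_of_nonneg_left h4 (abs_nonneg _))
  let Y : H₁ × H₂ →L[ℂ] H₂ := M ∘L (ContinuousLinearMap.snd ℂ H₁ H₂ +
    C ∘L R ∘L ContinuousLinearMap.fst ℂ H₁ H₂)
  let X : H₁ × H₂ →L[ℂ] H₁ := R ∘L (ContinuousLinearMap.fst ℂ H₁ H₂ - B ∘L Y)
  have hYv : ∀ p, Y p = M (p.2 + C (R p.1)) := fun p => rfl
  have hXv : ∀ p, X p = R (p.1 - B (Y p)) := fun p => rfl
  have hY : ∀ (x : A.domain) (y : D.domain),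
      Y (A x + B y - z • (x : H₁), -(C x) + D y - z • (y : H₂)) = y := by
    intro x y
    have h1 : R (A x + B y - z • (x : H₁)) = x + R (B y) := by
      rw [add_sub_right_comm, map_add, hR₁]
    rw [hYv]
    refine Eq.trans ?_ (hM₁ y)
    rw [h1, hK, map_add C]
    congr 1
    change -(C x) + D y - z • (y : H₂) + (C x + C (R (B y))) = D y + (C (R (B y)) - z • (y : H₂))
    abel
  refine ⟨X, Y, ?_, hY, ?_⟩
  · intro x y
    rw [hXv, hY]
    simp only
    rw [add_sub_right_comm, add_sub_cancel_right, hR₁]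
  · intro p
    obtain ⟨h₁, e₁⟩ := hR₂ (p.1 - B (Y p))
    obtain ⟨h₂, e₂⟩ := hM₂ (p.2 + C (R p.1))
    refine ⟨h₁, h₂, ?_, ?_⟩
    · rw [add_sub_right_comm]
      exact eq_sub_iff_add_eq.1 e₁
    · have e₂' : D ⟨Y p, h₂⟩ + (C (R (B (Y p))) - z • Y p) = p.2 + C (R p.1) := by
        rw [← hK]; exact e₂
      rw [hXv, map_sub, map_sub]
      rw [← add_sub_cancel_right p.2 (C (R p.1)), ← e₂']
      abel

/-- A non-real `z` is in the resolvent set of the block operator if `(A - z)⁻¹ B` is a strict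
contraction. -/
theorem blockOperator_mem_resolventPoints_of_left {A : H₁ →ₗ.[ℂ] H₁} (hA : IsSelfAdjoint A)
    {D : H₂ →ₗ.[ℂ] H₂} (hD : IsSelfAdjoint D) (B : H₂ →L[ℂ] H₁) {z : ℂ} (hz : z.im ≠ 0)
    {R : H₁ →L[ℂ] H₁}
    (hR : A.IsResolvent z R)
    {q : ℝ} (hq : q < 1) (hB : ∀ y, ‖R (B y)‖ ^ 2 ≤ q * ‖y‖ ^ 2) :
    z ∈ (blockOperator A B (-ContinuousLinearMap.adjoint B) D).resolventPoints := by
  obtain ⟨X, Y, hX, hY, h⟩ := exists_schur_inverse hA hD B hz hR hq hB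
  exact blockOperator_mem_resolventPoints A B _ D z X Y hX hY h

/-- A non-real `z` is in the resolvent set of the block operator if `(D - z)⁻¹ B*` is a strict
contraction. -/
theorem blockOperator_mem_resolventPoints_of_right {A : H₁ →ₗ.[ℂ] H₁} (hA : IsSelfAdjoint A)
    {D : H₂ →ₗ.[ℂ] H₂} (hD : IsSelfAdjoint D) (B : H₂ →L[ℂ] H₁) {z : ℂ} (hz : z.im ≠ 0)
    {R : H₂ →L[ℂ] H₂}
    (hR : D.IsResolvent z R)
    {q : ℝ} (hq : q < 1)
    (hB : ∀ x, ‖R (ContinuousLinearMap.adjoint B x)‖ ^ 2 ≤ q * ‖x‖ ^ 2) :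
    z ∈ (blockOperator A B (-ContinuousLinearMap.adjoint B) D).resolventPoints := by
  -- Exchange the two components: `[[D, -B*], [B, A]]` has the form treated above.
  obtain ⟨Y, X, hY, hX, h⟩ := exists_schur_inverse hD hA (-ContinuousLinearMap.adjoint B) hz
    hR hq (by simpa using hB)
  have hadj : ∀ y, -(ContinuousLinearMap.adjoint (-ContinuousLinearMap.adjoint B) y) = B y := by
    intro y; simp
  simp only [hadj] at hX hY h
  let s : H₁ × H₂ →L[ℂ] H₂ × H₁ := ContinuousLinearEquiv.prodComm ℂ H₁ H₂
  refine blockOperator_mem_resolventPoints A B _ D z (X ∘L s) (Y ∘L s) ?_ ?_ ?_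
  · intro x y
    have := hX y x
    rwa [add_comm (D y), add_comm (B y)] at this
  · intro x y
    have := hY y x
    rwa [add_comm (D y), add_comm (B y)] at this
  · intro p
    obtain ⟨h₁, h₂, e₁, e₂⟩ := h (s p)
    refine ⟨h₂, h₁, ?_, ?_⟩
    · rw [add_comm]; exact e₂
    · rw [add_comm]; exact e₁

end Schur

open MeasureTheory Filter Topology ENNReal

/-! ### Bounded Borel functions -/

section BoundedMeasurable

variable {X : Type*} [MeasurableSpace X]

/-- Bounded Borel functions with complex values, the functions for which the functional calculus
is defined. -/
def BddMeasurable (φ : X → ℂ) : Prop := Measurable φ ∧ ∃ C : ℝ, ∀ t, ‖φ t‖ ≤ C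

namespace BddMeasurable

variable {φ ψ : X → ℂ}

theorem const (c : ℂ) : BddMeasurable fun _ : X => c := ⟨measurable_const, ‖c‖, fun _ => le_rfl⟩

theorem add (hφ : BddMeasurable φ) (hψ : BddMeasurable ψ) : BddMeasurable fun t => φ t + ψ t := by
  obtain ⟨h1, C, hC⟩ := hφ
  obtain ⟨h2, C', hC'⟩ := hψ
  exact ⟨h1.add h2, C + C', fun t => (norm_add_le _ _).trans (add_le_add (hC t) (hC' t))⟩

theorem mul (hφ : BddMeasurable φ) (hψ : BddMeasurable ψ) : BddMeasurable fun t => φ t * ψ t := by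
  obtain ⟨h1, C, hC⟩ := hφ
  obtain ⟨h2, C', hC'⟩ := hψ
  refine ⟨h1.mul h2, C * C', fun t => ?_⟩
  rw [norm_mul]
  exact mul_le_mul (hC t) (hC' t) (norm_nonneg _) ((norm_nonneg _).trans (hC t))

theorem const_mul (c : ℂ) (hφ : BddMeasurable φ) : BddMeasurable fun t => c * φ t :=
  (const c).mul hφ

theorem conj (hφ : BddMeasurable φ) : BddMeasurable fun t => (starRingEnd ℂ) (φ t) := by
  obtain ⟨h1, C, hC⟩ := hφ
  exact ⟨Complex.continuous_conj.measurable.comp h1, C, fun t => by simpa using hC t⟩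

theorem indicator_one {s : Set X} (hs : MeasurableSet s) :
    BddMeasurable (s.indicator fun _ => (1 : ℂ)) := by
  refine ⟨measurable_const.indicator hs, 1, fun t => ?_⟩
  by_cases h : t ∈ s <;> simp [h]

theorem simpleFunc (s : SimpleFunc X ℂ) : BddMeasurable s := by
  obtain ⟨C, hC⟩ := s.exists_forall_norm_le
  exact ⟨s.measurable, C, hC⟩

theorem memLp (hφ : BddMeasurable φ) (p : ℝ≥0∞) (ν : Measure X) [IsFiniteMeasure ν] :
    MemLp φ p ν := by
  obtain ⟨h1, C, hC⟩ := hφ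
  exact MemLp.of_bound h1.aestronglyMeasurable C (Eventually.of_forall hC)

theorem integrable (hφ : BddMeasurable φ) (ν : Measure X) [IsFiniteMeasure ν] :
    Integrable φ ν := memLp_one_iff_integrable.1 (hφ.memLp 1 ν)

theorem integrable_norm_sq (hφ : BddMeasurable φ) (ν : Measure X) [IsFiniteMeasure ν] :
    Integrable (fun t => ‖φ t‖ ^ 2) ν :=
  (memLp_two_iff_integrable_sq_norm hφ.1.aestronglyMeasurable).1 (hφ.memLp 2 ν)

theorem enorm_eq_eLpNorm_iff (hφ : BddMeasurable φ) (ν : Measure X) [IsFiniteMeasure ν]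
    {E : Type*} [NormedAddCommGroup E] (v : E) :
    ‖v‖ₑ = eLpNorm φ 2 ν ↔ ‖v‖ ^ 2 = ∫ t, ‖φ t‖ ^ 2 ∂ν := by
  have h0 : 0 ≤ ∫ t, ‖φ t‖ ^ 2 ∂ν := integral_nonneg fun t => by positivity
  rw [(hφ.memLp 2 ν).eLpNorm_eq_integral_rpow_norm two_ne_zero ENNReal.ofNat_ne_top,
    ← ofReal_norm]
  simp only [toReal_ofNat, Real.rpow_ofNat]
  rw [ENNReal.ofReal_eq_ofReal_iff (norm_nonneg _) (by positivity),
    show (2 : ℝ)⁻¹ = 1 / 2 by norm_num, ← Real.sqrt_eq_rpow]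
  constructor
  · intro h
    rw [h, Real.sq_sqrt h0]
  · intro h
    rw [← h, Real.sqrt_sq (norm_nonneg _)]

end BddMeasurable

end BoundedMeasurable

/-! ### Extension of a functional calculus by `L²` density -/

section Extension

theorem ContinuousLinearMap.eq_of_inner_self {H : Type*} [NormedAddCommGroup H]
    [InnerProductSpace ℂ H] {F G : H →L[ℂ] H}
    (h : ∀ x, ⟪x, F x⟫_ℂ = ⟪x, G x⟫_ℂ) : F = G := by
  have : (F : H →ₗ[ℂ] H) = G := by
    rw [← ext_inner_map]
    intro x
    have := congrArg (starRingEnd ℂ) (h x)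
    rwa [inner_conj_symm, inner_conj_symm] at this
  ext x
  exact congrArg (fun T : H →ₗ[ℂ] H => T x) this

variable {X ι H : Type*} [MeasurableSpace X] [NormedAddCommGroup H] [InnerProductSpace ℂ H]
  [CompleteSpace H]

/-- Let `μ x` be the scalar spectral measures of a family of operators `F i` that represent
functions `a i`, in the sense that `⟨x, F i x⟩ = ∫ a i dμ x` and `‖F i x‖ ^ 2 = ∫ ‖a i‖ ^ 2 dμ x`.
If the functions `a i` are closed under subtraction and dense in `L²` of every finite measure, then
every bounded Borel function `φ` is represented by an operator. The value at `x` is the limit of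
`F i x` as `a i → φ` in `L²(μ x)`; linearity follows by approximating with respect to the sum of the
measures of all the vectors involved. -/
theorem exists_operator_of_dense (μ : H → Measure X)
    (hμ : ∀ x, μ x Set.univ = ENNReal.ofReal (‖x‖ ^ 2)) (a : ι → X → ℂ) (F : ι → H →L[ℂ] H)
    (ha : ∀ i, BddMeasurable (a i))
    (hsub : ∀ i j, ∃ k, a k = a i - a j ∧ F k = F i - F j)
    (hnorm : ∀ i x, ‖F i x‖ ^ 2 = ∫ t, ‖a i t‖ ^ 2 ∂μ x)
    (hquad : ∀ i x, ⟪x, F i x⟫_ℂ = ∫ t, a i t ∂μ x)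
    (hdense : ∀ (ν : Measure X) [IsFiniteMeasure ν] (φ : X → ℂ), MemLp φ 2 ν → ∀ ε : ℝ≥0∞, ε ≠ 0 →
      ∃ i, eLpNorm (φ - a i) 2 ν ≤ ε)
    {φ : X → ℂ} (hφ : BddMeasurable φ) :
    ∃ G : H →L[ℂ] H, ∀ x, ⟪x, G x⟫_ℂ = ∫ t, φ t ∂μ x ∧ ‖G x‖ ^ 2 = ∫ t, ‖φ t‖ ^ 2 ∂μ x := by
  have hfin : ∀ x, IsFiniteMeasure (μ x) := fun x => ⟨by rw [hμ]; exact ENNReal.ofReal_lt_top⟩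
  have hF : ∀ i j x, ‖F i x - F j x‖ₑ = eLpNorm (a i - a j) 2 (μ x) := by
    intro i j x
    obtain ⟨k, h1, h2⟩ := hsub i j
    rw [← h1, ← sub_apply, ← h2]
    exact ((ha k).enorm_eq_eLpNorm_iff (μ x) _).2 (hnorm k x)
  have hseq : ∀ (ν : Measure X) [IsFiniteMeasure ν], ∃ u : ℕ → ι,
      Tendsto (fun n => eLpNorm (a (u n) - φ) 2 ν) atTop (𝓝 0) := by
    intro ν _
    choose u hu using fun n : ℕ => hdense ν φ (hφ.memLp 2 ν) ((n : ℝ≥0∞)⁻¹)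
      (ENNReal.inv_ne_zero.2 (ENNReal.natCast_ne_top n))
    refine ⟨u, tendsto_of_tendsto_of_tendsto_of_le_of_le tendsto_const_nhds
      ENNReal.tendsto_inv_nat_nhds_zero (fun _ => zero_le) fun n => ?_⟩
    simp only
    rw [eLpNorm_sub_comm]
    exact hu n
  have haφ : ∀ i (ν : Measure X), AEStronglyMeasurable (a i - φ) ν := fun i ν =>
    ((ha i).1.sub hφ.1).aestronglyMeasurable
  have htri : ∀ i j (ν : Measure X), eLpNorm (a i - a j) 2 ν ≤
      eLpNorm (a i - φ) 2 ν + eLpNorm (a j - φ) 2 ν := by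
    intro i j ν
    rw [show a i - a j = (a i - φ) - (a j - φ) by abel]
    exact eLpNorm_sub_le (haφ i ν) (haφ j ν) (by norm_num)
  have hlim : ∀ x, ∃ l : H, ∀ i, ‖F i x - l‖ₑ ≤ eLpNorm (a i - φ) 2 (μ x) := by
    intro x
    have := hfin x
    obtain ⟨u, hu⟩ := hseq (μ x)
    have hc : CauchySeq fun n => F (u n) x := by
      rw [EMetric.cauchySeq_iff]
      intro ε hε
      have h2 : 0 < ε / 2 := ENNReal.half_pos hε.ne'
      obtain ⟨N, hN⟩ := eventually_atTop.1 (hu.eventually (gt_mem_nhds h2))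
      refine ⟨N, fun m hm n hn => ?_⟩
      rw [edist_eq_enorm_sub, hF]
      refine (htri _ _ _).trans_lt ?_
      rw [← ENNReal.add_halves ε]
      exact ENNReal.add_lt_add (hN m hm) (hN n hn)
    obtain ⟨l, hl⟩ := cauchySeq_tendsto_of_complete hc
    refine ⟨l, fun i => ?_⟩
    have h1 : Tendsto (fun n => ‖F i x - F (u n) x‖ₑ) atTop (𝓝 ‖F i x - l‖ₑ) :=
      (tendsto_const_nhds.sub hl).enorm
    have h2 : Tendsto (fun n => eLpNorm (a i - φ) 2 (μ x) + eLpNorm (a (u n) - φ) 2 (μ x)) atTop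
        (𝓝 (eLpNorm (a i - φ) 2 (μ x) + 0)) := tendsto_const_nhds.add hu
    rw [add_zero] at h2
    exact le_of_tendsto_of_tendsto' h1 h2 fun n => by rw [hF]; exact htri _ _ _
  choose L hL using hlim
  have hconv : ∀ (x : H) (ν : Measure X) (u : ℕ → ι), μ x ≤ ν →
      Tendsto (fun n => eLpNorm (a (u n) - φ) 2 ν) atTop (𝓝 0) →
      Tendsto (fun n => F (u n) x) atTop (𝓝 (L x)) := by
    intro x ν u hν hu
    rw [tendsto_iff_edist_tendsto_0]
    refine tendsto_of_tendsto_of_tendsto_of_le_of_le tendsto_const_nhds hu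
      (fun _ => zero_le) fun n => ?_
    rw [edist_eq_enorm_sub]
    exact (hL x _).trans (eLpNorm_mono_measure _ hν)
  have hnormL : ∀ x, ‖L x‖ ^ 2 = ∫ t, ‖φ t‖ ^ 2 ∂μ x := by
    intro x
    have := hfin x
    rw [← hφ.enorm_eq_eLpNorm_iff]
    obtain ⟨u, hu⟩ := hseq (μ x)
    have h1 := (hconv x (μ x) u le_rfl hu).enorm
    have h2 : Tendsto (fun n => ‖F (u n) x‖ₑ + eLpNorm (a (u n) - φ) 2 (μ x)) atTop
        (𝓝 (‖L x‖ₑ + 0)) := h1.add hu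
    have h3 : Tendsto (fun n => eLpNorm φ 2 (μ x) + eLpNorm (a (u n) - φ) 2 (μ x)) atTop
        (𝓝 (eLpNorm φ 2 (μ x) + 0)) := tendsto_const_nhds.add hu
    rw [add_zero] at h2 h3
    have hFi : ∀ n, ‖F (u n) x‖ₑ = eLpNorm (a (u n)) 2 (μ x) := fun n =>
      ((ha _).enorm_eq_eLpNorm_iff (μ x) _).2 (hnorm _ x)
    apply le_antisymm
    · refine le_of_tendsto_of_tendsto' h1 h3 fun n => ?_
      rw [hFi]
      calc eLpNorm (a (u n)) 2 (μ x) = eLpNorm (φ + (a (u n) - φ)) 2 (μ x) := by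
            rw [add_sub_cancel]
        _ ≤ _ := eLpNorm_add_le hφ.1.aestronglyMeasurable (haφ _ _) (by norm_num)
    · refine le_of_tendsto_of_tendsto' tendsto_const_nhds h2 fun n => ?_
      rw [hFi]
      calc eLpNorm φ 2 (μ x) = eLpNorm (a (u n) - (a (u n) - φ)) 2 (μ x) := by
            congr 1; abel
        _ ≤ _ := eLpNorm_sub_le (ha _).1.aestronglyMeasurable (haφ _ _) (by norm_num)
  obtain ⟨C, hC⟩ := hφ.2
  have hC0 : ∀ x, ‖L x‖ ≤ |C| * ‖x‖ := by
    intro x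
    have := hfin x
    refine abs_le_of_sq_le_sq' ?_ (by positivity) |>.2
    rw [hnormL, mul_pow]
    have h1 : ∫ t, ‖φ t‖ ^ 2 ∂μ x ≤ ∫ t, |C| ^ 2 ∂μ x := by
      refine integral_mono (hφ.integrable_norm_sq _) (integrable_const _) fun t => ?_
      exact pow_le_pow_left₀ (norm_nonneg _) ((hC t).trans (le_abs_self C)) 2
    refine h1.trans_eq ?_
    rw [integral_const, Measure.real, hμ, ENNReal.toReal_ofReal (by positivity), smul_eq_mul,
      mul_comm]
  let G : H →L[ℂ] H := LinearMap.mkContinuous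
    { toFun := L
      map_add' := by
        intro x y
        have := hfin x
        have := hfin y
        have := hfin (x + y)
        obtain ⟨u, hu⟩ := hseq (μ x + μ y + μ (x + y))
        have h1 := hconv x _ u (Measure.le_add_right (Measure.le_add_right le_rfl)) hu
        have h2 := hconv y _ u (Measure.le_add_right (Measure.le_add_left le_rfl)) hu
        have h3 := hconv (x + y) _ u (Measure.le_add_left le_rfl) hu
        simp_rw [map_add] at h3
        exact tendsto_nhds_unique h3 (h1.add h2)
      map_smul' := by
        intro c x
        have := hfin x
        have := hfin (c • x)
        obtain ⟨u, hu⟩ := hseq (μ x + μ (c • x))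
        have h1 := hconv x _ u (Measure.le_add_right le_rfl) hu
        have h3 := hconv (c • x) _ u (Measure.le_add_left le_rfl) hu
        simp_rw [map_smul] at h3
        exact tendsto_nhds_unique h3 (h1.const_smul c) } |C| hC0
  refine ⟨G, fun x => ⟨?_, hnormL x⟩⟩
  have := hfin x
  obtain ⟨u, hu⟩ := hseq (μ x)
  have h1 : Tendsto (fun n => ⟪x, F (u n) x⟫_ℂ) atTop (𝓝 ⟪x, L x⟫_ℂ) :=
    tendsto_const_nhds.inner (hconv x (μ x) u le_rfl hu)
  have h2 : Tendsto (fun n => eLpNorm (a (u n) - φ) 1 (μ x)) atTop (𝓝 0) := by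
    have hb : ∀ n, eLpNorm (a (u n) - φ) 1 (μ x) ≤
        eLpNorm (a (u n) - φ) 2 (μ x) * μ x Set.univ ^ (1 / (1 : ℝ≥0∞).toReal - 1 / (2 : ℝ≥0∞).toReal) :=
      fun n => eLpNorm_le_eLpNorm_mul_rpow_measure_univ (by norm_num) (haφ _ _)
    refine tendsto_of_tendsto_of_tendsto_of_le_of_le tendsto_const_nhds ?_ (fun _ => zero_le) hb
    have := ENNReal.Tendsto.mul_const (b := μ x Set.univ ^ (1 / (1 : ℝ≥0∞).toReal - 1 / (2 : ℝ≥0∞).toReal))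
      hu (Or.inr (ENNReal.rpow_ne_top_of_nonneg (by norm_num) (measure_ne_top _ _)))
    simpa using this
  have h3 := tendsto_integral_of_L1' φ hφ.1.aestronglyMeasurable
    (Eventually.of_forall fun n => (ha (u n)).integrable (μ x)) h2
  simp_rw [hquad] at h1
  exact tendsto_nhds_unique h1 h3

end Extension

/-! ### The functional calculus of a projection-valued measure -/

namespace ProjectionMeasure

variable {H : Type*} [NormedAddCommGroup H] [InnerProductSpace ℂ H] [CompleteSpace H]
  (E : ProjectionMeasure H)

theorem scalarMeasure_apply (x : H) {s : Set ℝ} (hs : MeasurableSet s) :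
    E.scalarMeasure x s = ENNReal.ofReal (‖E.proj s x‖ ^ 2) :=
  Measure.ofMeasurable_apply s hs

theorem scalarMeasure_univ (x : H) : E.scalarMeasure x Set.univ = ENNReal.ofReal (‖x‖ ^ 2) := by
  rw [E.scalarMeasure_apply x MeasurableSet.univ, E.proj_univ]
  rfl

instance (x : H) : IsFiniteMeasure (E.scalarMeasure x) :=
  ⟨by rw [E.scalarMeasure_univ]; exact ENNReal.ofReal_lt_top⟩

theorem scalarMeasure_real (x : H) {s : Set ℝ} (hs : MeasurableSet s) :
    (E.scalarMeasure x).real s = ‖E.proj s x‖ ^ 2 := by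
  rw [Measure.real, E.scalarMeasure_apply x hs, ENNReal.toReal_ofReal (by positivity)]

theorem inner_proj_left {s : Set ℝ} (hs : MeasurableSet s) (x y : H) :
    ⟪E.proj s x, y⟫_ℂ = ⟪x, E.proj s y⟫_ℂ :=
  ContinuousLinearMap.isSelfAdjoint_iff_isSymmetric.mp (E.isStarProjection s hs).isSelfAdjoint x y

theorem proj_proj_self {s : Set ℝ} (hs : MeasurableSet s) (x : H) :
    E.proj s (E.proj s x) = E.proj s x :=
  congrArg (fun F : H →L[ℂ] H => F x) (E.isStarProjection s hs).isIdempotentElem.eq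

theorem inner_proj_self {s : Set ℝ} (hs : MeasurableSet s) (x : H) :
    ⟪x, E.proj s x⟫_ℂ = ((E.scalarMeasure x).real s : ℂ) := by
  rw [E.scalarMeasure_real x hs, ← E.proj_proj_self hs, ← E.inner_proj_left hs,
    inner_self_eq_norm_sq_to_K, E.proj_proj_self hs]
  norm_cast

theorem proj_union {s t : Set ℝ} (hs : MeasurableSet s) (ht : MeasurableSet t)
    (hst : Disjoint s t) : E.proj (s ∪ t) = E.proj s + E.proj t := by
  refine ContinuousLinearMap.eq_of_inner_self fun x => ?_
  rw [add_apply, inner_add_right, E.inner_proj_self (hs.union ht),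
    E.inner_proj_self hs, E.inner_proj_self ht, measureReal_union hst ht]
  push_cast
  rfl

theorem proj_proj_of_disjoint {s t : Set ℝ} (hs : MeasurableSet s) (ht : MeasurableSet t)
    (hst : Disjoint s t) (x : H) : E.proj s (E.proj t x) = 0 := by
  have h1 : ‖E.proj s (E.proj t x)‖ ^ 2 + ‖E.proj t x‖ ^ 2 ≤ ‖E.proj t x‖ ^ 2 := by
    set y := E.proj t x with hy
    have h2 : E.proj t y = y := E.proj_proj_self ht x
    calc ‖E.proj s y‖ ^ 2 + ‖y‖ ^ 2 = (E.scalarMeasure y).real (s ∪ t) := by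
          rw [measureReal_union hst ht, E.scalarMeasure_real y hs, E.scalarMeasure_real y ht, h2]
      _ ≤ (E.scalarMeasure y).real Set.univ := measureReal_mono (Set.subset_univ _)
      _ = ‖y‖ ^ 2 := by
          rw [E.scalarMeasure_real y MeasurableSet.univ, E.proj_univ]
          rfl
  have h3 : ‖E.proj s (E.proj t x)‖ ^ 2 ≤ 0 := by linarith
  exact norm_eq_zero.1 (pow_eq_zero_iff two_ne_zero |>.1 (le_antisymm h3 (by positivity)))

/-- The operator `∑ c • E(φ = c)`, the integral of a simple function `φ`. -/
noncomputable def simpleIntegral (φ : SimpleFunc ℝ ℂ) : H →L[ℂ] H :=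
  ∑ c ∈ φ.range, c • E.proj (φ ⁻¹' {c})

theorem inner_simpleIntegral (φ : SimpleFunc ℝ ℂ) (x : H) :
    ⟪x, E.simpleIntegral φ x⟫_ℂ = ∫ t, φ t ∂E.scalarMeasure x := by
  rw [← SimpleFunc.integral_eq_integral φ ((BddMeasurable.simpleFunc φ).integrable _),
    SimpleFunc.integral_eq, simpleIntegral, sum_apply, inner_sum]
  refine Finset.sum_congr rfl fun c _ => ?_
  rw [smul_apply, inner_smul_right, E.inner_proj_self (φ.measurableSet_preimage _),
    Complex.real_smul, mul_comm]

theorem norm_sq_simpleIntegral (φ : SimpleFunc ℝ ℂ) (x : H) :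
    ‖E.simpleIntegral φ x‖ ^ 2 = ∫ t, ‖φ t‖ ^ 2 ∂E.scalarMeasure x := by
  have h1 : ∫ t, ‖φ t‖ ^ 2 ∂E.scalarMeasure x =
      ∑ c ∈ φ.range, (E.scalarMeasure x).real (φ ⁻¹' {c}) • ‖c‖ ^ 2 := by
    rw [← SimpleFunc.map_integral φ (fun c => ‖c‖ ^ 2)
      ((BddMeasurable.simpleFunc φ).integrable _) (by simp), SimpleFunc.integral_eq_integral]
    · rfl
    · exact (BddMeasurable.simpleFunc φ).integrable_norm_sq _
  have h2 : (⟪E.simpleIntegral φ x, E.simpleIntegral φ x⟫_ℂ) =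
      ((∑ c ∈ φ.range, (E.scalarMeasure x).real (φ ⁻¹' {c}) • ‖c‖ ^ 2 : ℝ) : ℂ) := by
    rw [simpleIntegral, sum_apply, sum_inner, Complex.ofReal_sum]
    refine Finset.sum_congr rfl fun c hc => ?_
    rw [inner_sum, Finset.sum_eq_single c]
    · rw [smul_apply, inner_smul_left, inner_smul_right,
        E.inner_proj_left (φ.measurableSet_preimage _),
        E.proj_proj_self (φ.measurableSet_preimage _),
        E.inner_proj_self (φ.measurableSet_preimage _), ← mul_assoc, Complex.conj_mul']
      rw [smul_eq_mul, mul_comm]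
      push_cast
      rfl
    · intro d _ hd
      rw [smul_apply, smul_apply, inner_smul_left, inner_smul_right,
        E.inner_proj_left (φ.measurableSet_preimage _), E.proj_proj_of_disjoint
        (φ.measurableSet_preimage _) (φ.measurableSet_preimage _), inner_zero_right]
      · simp
      · exact Disjoint.preimage _ (by simpa using hd.symm)
    · intro h; exact absurd hc h
  rw [h1, ← Complex.ofReal_inj, ← h2, inner_self_eq_norm_sq_to_K]
  norm_cast

theorem exists_integral {φ : ℝ → ℂ} (hφ : BddMeasurable φ) :
    ∃ G : H →L[ℂ] H, ∀ x, ⟪x, G x⟫_ℂ = ∫ t, φ t ∂E.scalarMeasure x ∧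
      ‖G x‖ ^ 2 = ∫ t, ‖φ t‖ ^ 2 ∂E.scalarMeasure x := by
  refine exists_operator_of_dense E.scalarMeasure E.scalarMeasure_univ
    (fun s : SimpleFunc ℝ ℂ => (s : ℝ → ℂ)) E.simpleIntegral
    (fun s => BddMeasurable.simpleFunc s) ?_ E.norm_sq_simpleIntegral E.inner_simpleIntegral
    ?_ hφ
  · intro s t
    refine ⟨s - t, SimpleFunc.coe_sub s t, ContinuousLinearMap.eq_of_inner_self fun x => ?_⟩
    rw [sub_apply, inner_sub_right, inner_simpleIntegral, inner_simpleIntegral,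
      inner_simpleIntegral, SimpleFunc.coe_sub]
    exact integral_sub ((BddMeasurable.simpleFunc s).integrable _)
      ((BddMeasurable.simpleFunc t).integrable _)
  · intro ν _ ψ hψ ε hε
    obtain ⟨g, hg, -⟩ := hψ.exists_simpleFunc_eLpNorm_sub_lt ENNReal.ofNat_ne_top hε
    exact ⟨g, hg.le⟩

/-- The operator `∫ φ dE`, for bounded Borel functions `φ`. -/
noncomputable def integral (φ : ℝ → ℂ) : H →L[ℂ] H :=
  Classical.epsilon fun G => ∀ x, ⟪x, G x⟫_ℂ = ∫ t, φ t ∂E.scalarMeasure x ∧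
    ‖G x‖ ^ 2 = ∫ t, ‖φ t‖ ^ 2 ∂E.scalarMeasure x

section Calculus

variable {φ ψ : ℝ → ℂ}

theorem inner_integral (hφ : BddMeasurable φ) (x : H) :
    ⟪x, E.integral φ x⟫_ℂ = ∫ t, φ t ∂E.scalarMeasure x :=
  (Classical.epsilon_spec (E.exists_integral hφ) x).1

theorem norm_sq_integral (hφ : BddMeasurable φ) (x : H) :
    ‖E.integral φ x‖ ^ 2 = ∫ t, ‖φ t‖ ^ 2 ∂E.scalarMeasure x :=
  (Classical.epsilon_spec (E.exists_integral hφ) x).2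

/-- The operator `∫ φ dE` is determined by its quadratic form. -/
theorem eq_integral (hφ : BddMeasurable φ) {F : H →L[ℂ] H}
    (h : ∀ x, ⟪x, F x⟫_ℂ = ∫ t, φ t ∂E.scalarMeasure x) : F = E.integral φ :=
  ContinuousLinearMap.eq_of_inner_self fun x => (h x).trans (E.inner_integral hφ x).symm

theorem integral_add (hφ : BddMeasurable φ) (hψ : BddMeasurable ψ) :
    E.integral (fun t => φ t + ψ t) = E.integral φ + E.integral ψ := by
  refine (E.eq_integral (hφ.add hψ) fun x => ?_).symm
  rw [add_apply, inner_add_right, E.inner_integral hφ, E.inner_integral hψ]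
  exact (MeasureTheory.integral_add (hφ.integrable _) (hψ.integrable _)).symm

theorem integral_const_mul (c : ℂ) (hφ : BddMeasurable φ) :
    E.integral (fun t => c * φ t) = c • E.integral φ := by
  refine (E.eq_integral (hφ.const_mul c) fun x => ?_).symm
  rw [smul_apply, inner_smul_right, E.inner_integral hφ]
  exact (MeasureTheory.integral_const_mul _ _).symm

theorem integral_conj (hφ : BddMeasurable φ) :
    E.integral (fun t => (starRingEnd ℂ) (φ t)) = ContinuousLinearMap.adjoint (E.integral φ) := by
  refine (E.eq_integral hφ.conj fun x => ?_).symm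
  rw [ContinuousLinearMap.adjoint_inner_right, ← inner_conj_symm, E.inner_integral hφ]
  exact _root_.integral_conj.symm

theorem integral_indicator_one {s : Set ℝ} (hs : MeasurableSet s) :
    E.integral (s.indicator fun _ => 1) = E.proj s := by
  refine (E.eq_integral (BddMeasurable.indicator_one hs) fun x => ?_).symm
  rw [E.inner_proj_self hs, integral_indicator_const _ hs]
  simp

/-- Polarization in the function: the norm identity for `φ + c ψ` yields the inner products, and
with them the multiplicativity of the calculus. -/
theorem inner_integral_integral (hφ : BddMeasurable φ) (hψ : BddMeasurable ψ) (x : H) :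
    ⟪E.integral φ x, E.integral ψ x⟫_ℂ =
      ∫ t, (starRingEnd ℂ) (φ t) * ψ t ∂E.scalarMeasure x := by
  have hre : ∀ {ψ : ℝ → ℂ}, BddMeasurable ψ → (⟪E.integral φ x, E.integral ψ x⟫_ℂ).re =
      (∫ t, (starRingEnd ℂ) (φ t) * ψ t ∂E.scalarMeasure x).re := by
    intro ψ hψ
    have h1 := E.norm_sq_integral (hφ.add hψ) x
    rw [E.integral_add hφ hψ, add_apply, norm_add_sq (𝕜 := ℂ), E.norm_sq_integral hφ,
      E.norm_sq_integral hψ] at h1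
    have hi := (hφ.conj.mul hψ).integrable (E.scalarMeasure x)
    have h2 : ∀ t, ‖φ t + ψ t‖ ^ 2 =
        ‖φ t‖ ^ 2 + 2 * ((starRingEnd ℂ) (φ t) * ψ t).re + ‖ψ t‖ ^ 2 := by
      intro t
      rw [norm_add_sq (𝕜 := ℂ), RCLike.inner_apply, mul_comm (ψ t)]
      rfl
    simp_rw [h2] at h1
    have hre' : Integrable (fun t => ((starRingEnd ℂ) (φ t) * ψ t).re) (E.scalarMeasure x) := hi.re
    have h3 : ∫ t, ((starRingEnd ℂ) (φ t) * ψ t).re ∂E.scalarMeasure x =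
        (∫ t, (starRingEnd ℂ) (φ t) * ψ t ∂E.scalarMeasure x).re :=
      Complex.reCLM.integral_comp_comm hi
    rw [MeasureTheory.integral_add, MeasureTheory.integral_add,
      MeasureTheory.integral_const_mul, h3] at h1
    · simp only [RCLike.re_to_complex] at h1
      linarith
    · exact hφ.integrable_norm_sq _
    · exact hre'.const_mul 2
    · exact (hφ.integrable_norm_sq _).add (hre'.const_mul 2)
    · exact hψ.integrable_norm_sq _
  refine Complex.ext (hre hψ) ?_
  have h1 := hre (hψ.const_mul (-Complex.I))
  have h2 : ∀ t, (starRingEnd ℂ) (φ t) * (-Complex.I * ψ t) =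
      -Complex.I * ((starRingEnd ℂ) (φ t) * ψ t) := fun t => by ring
  simp_rw [h2] at h1
  rw [E.integral_const_mul _ hψ, smul_apply, inner_smul_right,
    MeasureTheory.integral_const_mul] at h1
  simpa using h1

theorem integral_mul (hφ : BddMeasurable φ) (hψ : BddMeasurable ψ) (x : H) :
    E.integral (fun t => φ t * ψ t) x = E.integral φ (E.integral ψ x) := by
  have : E.integral φ ∘L E.integral ψ = E.integral (fun t => φ t * ψ t) := by
    refine E.eq_integral (hφ.mul hψ) fun x => ?_
    have h := E.inner_integral_integral hφ.conj hψ x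
    rw [E.integral_conj hφ, ContinuousLinearMap.adjoint_inner_left] at h
    simpa using h
  rw [← this]
  rfl

theorem lintegral_scalarMeasure_integral (hφ : BddMeasurable φ) (x : H) {u : ℝ → ℝ≥0∞}
    (hu : Measurable u) : ∫⁻ t, u t ∂E.scalarMeasure (E.integral φ x) =
      ∫⁻ t, ENNReal.ofReal (‖φ t‖ ^ 2) * u t ∂E.scalarMeasure x := by
  have hm : Measurable fun t => ENNReal.ofReal (‖φ t‖ ^ 2) :=
    (hφ.1.norm.pow_const 2).ennreal_ofReal
  rw [← Pi.mul_def, ← lintegral_withDensity_eq_lintegral_mul _ hm hu]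
  congr 1
  ext s hs
  rw [E.scalarMeasure_apply _ hs, withDensity_apply _ hs, ← E.integral_indicator_one hs,
    ← E.integral_mul (BddMeasurable.indicator_one hs) hφ,
    E.norm_sq_integral ((BddMeasurable.indicator_one hs).mul hφ), ← lintegral_indicator hs,
    ofReal_integral_eq_lintegral_ofReal
      (((BddMeasurable.indicator_one hs).mul hφ).integrable_norm_sq _)
      (Eventually.of_forall fun t => by positivity)]
  refine lintegral_congr fun t => ?_
  by_cases ht : t ∈ s <;> simp [ht]

theorem scalarMeasure_integral (hφ : BddMeasurable φ) (x : H) :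
    E.scalarMeasure (E.integral φ x) =
      (E.scalarMeasure x).withDensity fun t => ENNReal.ofReal (‖φ t‖ ^ 2) := by
  have hm : Measurable fun t => ENNReal.ofReal (‖φ t‖ ^ 2) :=
    (hφ.1.norm.pow_const 2).ennreal_ofReal
  ext s hs
  rw [← lintegral_indicator_one hs, E.lintegral_scalarMeasure_integral hφ x
    (measurable_one.indicator hs), withDensity_apply _ hs, ← lintegral_indicator hs]
  refine lintegral_congr fun t => ?_
  by_cases ht : t ∈ s <;> simp [ht]

end Calculus

end ProjectionMeasure

/-! ### Spectral measures and resolvents -/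

section ResolventFunction

theorem sub_ofReal_ne_zero {z : ℂ} (hz : z.im ≠ 0) (t : ℝ) : (t : ℂ) - z ≠ 0 := by
  intro h
  exact hz (by rw [← sub_eq_zero.1 h, Complex.ofReal_im])

theorem abs_im_le_norm_ofReal_sub (z : ℂ) (t : ℝ) : |z.im| ≤ ‖(t : ℂ) - z‖ := by
  have := Complex.abs_im_le_norm ((t : ℂ) - z)
  simpa using this

theorem bddMeasurable_inv_sub {z : ℂ} (hz : z.im ≠ 0) :
    BddMeasurable fun t : ℝ => ((t : ℂ) - z)⁻¹ := by
  refine ⟨by fun_prop, |z.im|⁻¹, fun t => ?_⟩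
  rw [norm_inv]
  exact inv_anti₀ (abs_pos.2 hz) (abs_im_le_norm_ofReal_sub z t)

theorem norm_inv_sub_mul_abs_le {z : ℂ} (hz : z.im ≠ 0) (t : ℝ) :
    ‖((t : ℂ) - z)⁻¹‖ * |t| ≤ 1 + ‖z‖ / |z.im| := by
  have h1 : 0 < |z.im| := abs_pos.2 hz
  have h2 := abs_im_le_norm_ofReal_sub z t
  have h3 : 0 < ‖(t : ℂ) - z‖ := h1.trans_le h2
  have h4 : |t| ≤ ‖(t : ℂ) - z‖ + ‖z‖ := by
    have := norm_add_le ((t : ℂ) - z) z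
    simpa using this
  rw [norm_inv, inv_mul_le_iff₀ h3, mul_add, mul_one]
  refine h4.trans (add_le_add le_rfl ?_)
  rw [mul_div_assoc', le_div_iff₀ h1, mul_comm]
  exact mul_le_mul_of_nonneg_right h2 (norm_nonneg z)

end ResolventFunction

namespace ProjectionMeasure

variable {H : Type*} [NormedAddCommGroup H] [InnerProductSpace ℂ H] [CompleteSpace H]
  (E : ProjectionMeasure H) {z : ℂ}

/-- The range of `∫ (t - z)⁻¹ dE` lies in the domain of `∫ t dE`. -/
theorem lintegral_sq_integral_inv_sub_lt_top (hz : z.im ≠ 0) (y : H) :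
    ∫⁻ t, ENNReal.ofReal (t ^ 2)
      ∂E.scalarMeasure (E.integral (fun t => ((t : ℂ) - z)⁻¹) y) < ⊤ := by
  rw [E.lintegral_scalarMeasure_integral (bddMeasurable_inv_sub hz) y (by fun_prop)]
  have hle : ∀ t : ℝ, ENNReal.ofReal (‖((t : ℂ) - z)⁻¹‖ ^ 2) * ENNReal.ofReal (t ^ 2) ≤
      ENNReal.ofReal ((1 + ‖z‖ / |z.im|) ^ 2) := by
    intro t
    rw [← ENNReal.ofReal_mul (by positivity)]
    refine ENNReal.ofReal_le_ofReal ?_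
    rw [← sq_abs t, ← mul_pow]
    exact pow_le_pow_left₀ (by positivity) (norm_inv_sub_mul_abs_le hz t) 2
  refine (lintegral_mono hle).trans_lt ?_
  rw [lintegral_const]
  exact ENNReal.mul_lt_top ENNReal.ofReal_lt_top (measure_lt_top _ _)

/-- The quadratic form `∫ t d‖E(t)x‖²` at `x = R y`, with `R = ∫ (t - z)⁻¹ dE`, agrees with that of
the operator sending `R y` to `y + z R y`. -/
theorem integral_id_scalarMeasure_integral_inv_sub (hz : z.im ≠ 0) (y : H) :
    ((∫ t, t ∂E.scalarMeasure (E.integral (fun t => ((t : ℂ) - z)⁻¹) y) : ℝ) : ℂ) =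
      ⟪E.integral (fun t => ((t : ℂ) - z)⁻¹) y, y⟫_ℂ +
        z * (‖E.integral (fun t => ((t : ℂ) - z)⁻¹) y‖ : ℂ) ^ 2 := by
  have hb := bddMeasurable_inv_sub hz
  have h1 : ∫ t, t ∂E.scalarMeasure (E.integral (fun t => ((t : ℂ) - z)⁻¹) y) =
      ∫ t : ℝ, ‖((t : ℂ) - z)⁻¹‖ ^ 2 * t ∂E.scalarMeasure y := by
    rw [E.scalarMeasure_integral hb, integral_withDensity_eq_integral_toReal_smul
      (hb.1.norm.pow_const 2).ennreal_ofReal (Eventually.of_forall fun _ => ENNReal.ofReal_lt_top)]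
    refine integral_congr_ae (Eventually.of_forall fun t => ?_)
    simp only
    rw [ENNReal.toReal_ofReal (by positivity), smul_eq_mul]
  rw [h1, ← inner_conj_symm, E.inner_integral hb, ← Complex.ofReal_pow, E.norm_sq_integral hb,
    ← _root_.integral_conj, ← integral_complex_ofReal, ← integral_complex_ofReal, ← MeasureTheory.integral_const_mul,
    ← MeasureTheory.integral_add (hb.conj.integrable _)]
  · refine integral_congr_ae (Eventually.of_forall fun t => ?_)
    simp only [Complex.ofReal_mul, Complex.ofReal_pow]
    set w := (t : ℂ) - z with hw
    have hw0 : w ≠ 0 := sub_ofReal_ne_zero hz t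
    rw [← Complex.conj_mul', show (t : ℂ) = w + z by rw [hw]; ring]
    field_simp
  · have := ((hb.conj.mul hb).const_mul z).integrable (E.scalarMeasure y)
    refine this.congr (Eventually.of_forall fun t => ?_)
    simp only
    rw [Complex.conj_mul']
    norm_cast

theorem integral_injective {φ : ℝ → ℂ} (hφ : BddMeasurable φ) (h0 : ∀ t, φ t ≠ 0) {w : H}
    (hw : E.integral φ w = 0) : w = 0 := by
  have h1 := E.norm_sq_integral hφ w
  rw [hw, norm_zero, zero_pow two_ne_zero, eq_comm,
    integral_eq_zero_iff_of_nonneg (fun t => by positivity) (hφ.integrable_norm_sq _)] at h1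
  have h2 : E.scalarMeasure w Set.univ = 0 := by
    refine measure_mono_null (fun t _ => ?_) h1
    simp [h0 t]
  rw [E.scalarMeasure_univ, ENNReal.ofReal_eq_zero] at h2
  exact norm_eq_zero.1 (pow_eq_zero_iff two_ne_zero |>.1 (le_antisymm h2 (by positivity)))

/-- If `E` is the spectral measure of `T` then `P = ∫ (t - z)⁻¹ dE` is a right inverse of `T - z`.
With `N = (T - z) P - 1` the equality of the quadratic forms on the domain says `⟨P y, N y⟩ = 0` for
all `y`, so `P* N = 0` by polarization, and `P*` is injective. -/
theorem IsSpectralMeasureOf.apply_integral_inv_sub {E : ProjectionMeasure H} {T : H →ₗ.[ℂ] H}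
    (hE : E.IsSpectralMeasureOf T) (hz : z.im ≠ 0) (y : H) :
    ∃ h : E.integral (fun t => ((t : ℂ) - z)⁻¹) y ∈ T.domain,
      T ⟨E.integral (fun t => ((t : ℂ) - z)⁻¹) y, h⟩ -
        z • E.integral (fun t => ((t : ℂ) - z)⁻¹) y = y := by
  have hb := bddMeasurable_inv_sub hz
  set P := E.integral fun t => ((t : ℂ) - z)⁻¹ with hP
  have hmem : ∀ y, P y ∈ T.domain := fun y =>
    (hE.1 _).2 (E.lintegral_sq_integral_inv_sub_lt_top hz y)
  let N : H →ₗ[ℂ] H := T.toFun ∘ₗ (P : H →ₗ[ℂ] H).codRestrict T.domain hmem -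
    z • (P : H →ₗ[ℂ] H) - LinearMap.id
  have hN : ∀ y, N y = T ⟨P y, hmem y⟩ - z • P y - y := fun y => rfl
  have h0 : ((ContinuousLinearMap.adjoint P : H →L[ℂ] H) : H →ₗ[ℂ] H) ∘ₗ N = 0 := by
    rw [← inner_map_self_eq_zero]
    intro y
    rw [LinearMap.comp_apply, ← inner_conj_symm]
    change (starRingEnd ℂ) ⟪y, ContinuousLinearMap.adjoint P (N y)⟫_ℂ = 0
    rw [ContinuousLinearMap.adjoint_inner_right, hN, inner_sub_right, inner_sub_right,
      hE.2 ⟨P y, hmem y⟩, E.integral_id_scalarMeasure_integral_inv_sub hz, inner_smul_right,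
      inner_self_eq_norm_sq_to_K, ← hP]
    simp
  refine ⟨hmem y, ?_⟩
  have h1 : ContinuousLinearMap.adjoint P (N y) = 0 := congrArg (fun F : H →ₗ[ℂ] H => F y) h0
  rw [hP, ← E.integral_conj hb] at h1
  have h2 := E.integral_injective hb.conj (fun t =>
    (map_ne_zero _).2 (inv_ne_zero (sub_ofReal_ne_zero hz t))) h1
  rw [hN] at h2
  exact sub_eq_zero.1 h2

/-- Vectors in the domain of `∫ t dE` lie in the range of `∫ (t - z)⁻¹ dE`: a preimage of `x` is the
limit of the truncated integrals of `t - z` over `[-n, n]`, applied to `x`. -/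
theorem exists_integral_inv_sub_eq (hz : z.im ≠ 0) {x : H}
    (hx : ∫⁻ t, ENNReal.ofReal (t ^ 2) ∂E.scalarMeasure x < ⊤) :
    ∃ y, E.integral (fun t => ((t : ℂ) - z)⁻¹) y = x := by
  have hb := bddMeasurable_inv_sub hz
  let I : ℕ → Set ℝ := fun n => Set.Icc (-(n : ℝ)) n
  have hI : ∀ n, MeasurableSet (I n) := fun n => measurableSet_Icc
  have hImono : ∀ {m n}, m ≤ n → I m ⊆ I n := fun {m n} h => by
    have : (m : ℝ) ≤ n := by exact_mod_cast h
    exact Set.Icc_subset_Icc (neg_le_neg this) this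
  let φ : ℕ → ℝ → ℂ := fun n => (I n).indicator fun t => (t : ℂ) - z
  have hφ : ∀ n, BddMeasurable (φ n) := by
    intro n
    refine ⟨Measurable.indicator (by fun_prop) (hI n), n + ‖z‖, fun t => ?_⟩
    by_cases ht : t ∈ I n
    · simp only [φ, Set.indicator_of_mem ht]
      refine (norm_sub_le _ _).trans (add_le_add ?_ le_rfl)
      rw [Complex.norm_real, Real.norm_eq_abs]
      exact abs_le.2 ht
    · simp only [φ, Set.indicator_of_notMem ht, norm_zero]
      positivity
  have hsq : Integrable (fun t : ℝ => t ^ 2) (E.scalarMeasure x) := by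
    refine ⟨by fun_prop, ?_⟩
    rw [hasFiniteIntegral_iff_ofReal (Eventually.of_forall fun t => by positivity)]
    exact hx
  have hsz : Integrable (fun t : ℝ => ‖(t : ℂ) - z‖ ^ 2) (E.scalarMeasure x) := by
    refine ((hsq.const_mul 2).add (integrable_const (2 * ‖z‖ ^ 2))).mono'
      (by fun_prop) (Eventually.of_forall fun t => ?_)
    have h1 := norm_sub_le (t : ℂ) z
    rw [Complex.norm_real, Real.norm_eq_abs] at h1
    rw [Real.norm_eq_abs, abs_of_nonneg (by positivity)]
    calc ‖(t : ℂ) - z‖ ^ 2 ≤ (|t| + ‖z‖) ^ 2 := pow_le_pow_left₀ (norm_nonneg _) h1 2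
      _ ≤ 2 * |t| ^ 2 + 2 * ‖z‖ ^ 2 := by nlinarith [sq_nonneg (|t| - ‖z‖)]
      _ = 2 * t ^ 2 + 2 * ‖z‖ ^ 2 := by rw [sq_abs]
  have htend : ∀ g : ℝ → ℝ, Integrable g (E.scalarMeasure x) →
      Tendsto (fun n => ∫ t, (I n)ᶜ.indicator g t ∂E.scalarMeasure x) atTop (𝓝 0) := by
    intro g hg
    have : Tendsto (fun n => ∫ t, (I n)ᶜ.indicator g t ∂E.scalarMeasure x) atTop
        (𝓝 (∫ _, 0 ∂E.scalarMeasure x)) := by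
      refine tendsto_integral_of_dominated_convergence (fun t => ‖g t‖)
        (fun n => hg.aestronglyMeasurable.indicator (hI n).compl) hg.norm
        (fun n => Eventually.of_forall fun t => norm_indicator_le_norm_self _ _)
        (Eventually.of_forall fun t => ?_)
      obtain ⟨N, hN⟩ := exists_nat_ge |t|
      refine tendsto_const_nhds.congr' (eventually_atTop.2 ⟨N, fun n hn => ?_⟩)
      have : t ∈ I n := hImono hn (abs_le.1 hN)
      simp [this]
    simpa using this
  have hcauchy : CauchySeq fun n => E.integral (φ n) x := by
    refine cauchySeq_of_le_tendsto_0
      (fun N => √(∫ t, (I N)ᶜ.indicator (fun t : ℝ => ‖(t : ℂ) - z‖ ^ 2) t ∂E.scalarMeasure x))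
      (fun n m N hn hm => ?_) ?_
    · rw [dist_eq_norm]
      refine Real.le_sqrt_of_sq_le ?_
      have hsub : E.integral (φ n) x - E.integral (φ m) x =
          E.integral (fun t => φ n t + (-1) * φ m t) x := by
        rw [E.integral_add (hφ n) ((hφ m).const_mul _), E.integral_const_mul _ (hφ m)]
        simp [sub_eq_add_neg]
      rw [hsub, E.norm_sq_integral ((hφ n).add ((hφ m).const_mul _))]
      refine integral_mono (((hφ n).add ((hφ m).const_mul _)).integrable_norm_sq _)
        (hsz.indicator (hI N).compl) fun t => ?_
      by_cases ht : t ∈ I N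
      · simp [φ, hImono hn ht, hImono hm ht, ht]
      · by_cases h1 : t ∈ I n <;> by_cases h2 : t ∈ I m <;> simp [φ, ht, h1, h2, norm_sub_rev]
    · have := (htend _ hsz).sqrt
      simpa using this
  obtain ⟨y, hy⟩ := cauchySeq_tendsto_of_complete hcauchy
  refine ⟨y, ?_⟩
  have h1 : Tendsto (fun n => E.integral (fun t => ((t : ℂ) - z)⁻¹) (E.integral (φ n) x)) atTop
      (𝓝 (E.integral (fun t => ((t : ℂ) - z)⁻¹) y)) :=
    ((E.integral fun t => ((t : ℂ) - z)⁻¹).continuous.tendsto y).comp hy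
  refine tendsto_nhds_unique h1 ?_
  have h2 : ∀ n, E.integral (fun t => ((t : ℂ) - z)⁻¹) (E.integral (φ n) x) = E.proj (I n) x := by
    intro n
    rw [← E.integral_mul hb (hφ n), ← E.integral_indicator_one (hI n)]
    congr 2
    ext t
    by_cases ht : t ∈ I n
    · simp [φ, ht, inv_mul_cancel₀ (sub_ofReal_ne_zero hz t)]
    · simp [φ, ht]
  simp_rw [h2]
  rw [tendsto_iff_norm_sub_tendsto_zero]
  have h3 : ∀ n, ‖E.proj (I n) x - x‖ =
      √(∫ t, (I n)ᶜ.indicator (fun _ => (1 : ℝ)) t ∂E.scalarMeasure x) := by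
    intro n
    have h4 : E.proj (I n) x - x = - E.proj (I n)ᶜ x := by
      have := congrArg (fun F : H →L[ℂ] H => F x)
        (E.proj_union (hI n) (hI n).compl disjoint_compl_right)
      rw [Set.union_compl_self, E.proj_univ] at this
      simp only [one_apply_eq_self, add_apply] at this
      nth_rewrite 2 [this]
      abel
    rw [h4, norm_neg, integral_indicator_const _ (hI n).compl, smul_eq_mul, mul_one,
      E.scalarMeasure_real x (hI n).compl, Real.sqrt_sq (norm_nonneg _)]
  simp_rw [h3]
  have := (htend _ (integrable_const (1 : ℝ))).sqrt
  simpa using this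

/-- A projection-valued measure is the spectral measure of `T` as soon as one resolvent of `T` is
the integral of the corresponding resolvent function. -/
theorem isSpectralMeasureOf_of_resolvent {T : H →ₗ.[ℂ] H} (hz : z.im ≠ 0)
    (h : T.IsResolvent z (E.integral fun t => ((t : ℂ) - z)⁻¹)) :
    E.IsSpectralMeasureOf T := by
  obtain ⟨h₁, h₂⟩ := h
  refine ⟨fun x => ⟨fun hx => ?_, fun hx => ?_⟩, fun x => ?_⟩
  · have h := E.lintegral_sq_integral_inv_sub_lt_top hz (T ⟨x, hx⟩ - z • x)
    rwa [h₁ ⟨x, hx⟩] at h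
  · obtain ⟨y, hy⟩ := E.exists_integral_inv_sub_eq hz hx
    rw [← hy]
    exact (h₂ y).1
  · have h3 := E.integral_id_scalarMeasure_integral_inv_sub hz (T x - z • (x : H))
    rw [h₁ x] at h3
    rw [h3, inner_sub_right, inner_smul_right, inner_self_eq_norm_sq_to_K]
    simp

end ProjectionMeasure

/-! ### Borel calculus of a commutative C*-algebra of operators -/

section Construction

variable {H : Type*} [NormedAddCommGroup H] [InnerProductSpace ℂ H] [CompleteSpace H]

/-- A projection-valued measure is obtained from its scalar measures, as soon as each Borel set is
represented by an operator. Additivity is inherited from the quadratic forms. -/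
theorem ProjectionMeasure.exists_of_scalarMeasures (ν : H → Measure ℝ)
    (hν : ∀ x, ν x Set.univ = ENNReal.ofReal (‖x‖ ^ 2))
    (hP : ∀ s, MeasurableSet s → ∃ P : H →L[ℂ] H, ∀ x, ⟪x, P x⟫_ℂ = ((ν x).real s : ℂ) ∧
      ‖P x‖ ^ 2 = (ν x).real s) :
    ∃ E : ProjectionMeasure H, ∀ x, E.scalarMeasure x = ν x := by
  classical
  have hfin : ∀ x, IsFiniteMeasure (ν x) := fun x => ⟨by rw [hν]; exact ENNReal.ofReal_lt_top⟩
  choose! P hP using hP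
  have hquad := fun s hs x => (hP s hs x).1
  have hnorm := fun s hs x => (hP s hs x).2
  have hadj : ∀ s, MeasurableSet s → ContinuousLinearMap.adjoint (P s) = P s := by
    intro s hs
    refine ContinuousLinearMap.eq_of_inner_self fun x => ?_
    rw [ContinuousLinearMap.adjoint_inner_right, ← inner_conj_symm, hquad s hs, Complex.conj_ofReal]
  have hidem : ∀ s, MeasurableSet s → P s * P s = P s := by
    intro s hs
    refine ContinuousLinearMap.eq_of_inner_self fun x => ?_
    rw [hquad s hs, ← hnorm s hs, mul_apply_eq_comp,
      ← ContinuousLinearMap.adjoint_inner_left, hadj s hs, inner_self_eq_norm_sq_to_K]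
    norm_cast
  have huniv : P Set.univ = 1 := by
    refine ContinuousLinearMap.eq_of_inner_self fun x => ?_
    rw [hquad _ MeasurableSet.univ, Measure.real, hν, ENNReal.toReal_ofReal (by positivity),
      one_apply_eq_self, inner_self_eq_norm_sq_to_K]
    norm_cast
  have hsum : ∀ s : ℕ → Set ℝ, (∀ i, MeasurableSet (s i)) →
      Pairwise (Function.onFun Disjoint s) →
      ∀ x, HasSum (fun i => P (s i) x) (P (⋃ i, s i) x) := by
    intro s hs hd x
    have hU := MeasurableSet.iUnion hs
    have h1 : HasSum (fun i => (ν x).real (s i)) ((ν x).real (⋃ i, s i)) := by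
      have h2 := measure_iUnion (μ := ν x) hd hs
      have h3 : ∑' i, ν x (s i) ≠ ⊤ := by rw [← h2]; exact measure_ne_top _ _
      have h4 := ENNReal.hasSum_toReal h3
      rwa [← ENNReal.tsum_toReal_eq (fun i => measure_ne_top _ _), ← h2] at h4
    have h2 : ∀ F : Finset ℕ, ‖∑ i ∈ F, P (s i) x - P (⋃ i, s i) x‖ =
        √((ν x).real (⋃ i, s i) - ∑ i ∈ F, (ν x).real (s i)) := by
      intro F
      have hV : MeasurableSet (⋃ i ∈ F, s i) := Finset.measurableSet_biUnion F fun i _ => hs i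
      have hVU : (⋃ i ∈ F, s i) ⊆ ⋃ i, s i := Set.iUnion₂_subset fun i _ => Set.subset_iUnion s i
      have hm : ∀ y, (ν y).real ((⋃ i, s i) \ ⋃ i ∈ F, s i) =
          (ν y).real (⋃ i, s i) - ∑ i ∈ F, (ν y).real (s i) := by
        intro y
        rw [measureReal_sdiff hVU hV, measureReal_biUnion_finset (fun i _ j _ hij => hd hij)
          fun i _ => hs i]
      have hop : P (⋃ i, s i) - ∑ i ∈ F, P (s i) = P ((⋃ i, s i) \ ⋃ i ∈ F, s i) := by
        refine ContinuousLinearMap.eq_of_inner_self fun y => ?_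
        rw [hquad _ (hU.diff hV), hm, sub_apply, inner_sub_right, hquad _ hU, sum_apply, inner_sum,
          Finset.sum_congr rfl fun i _ => hquad _ (hs i) y]
        push_cast
        rfl
      rw [norm_sub_rev, ← sum_apply, ← sub_apply, hop, ← hm, ← hnorm _ (hU.diff hV),
        Real.sqrt_sq (norm_nonneg _)]
    rw [HasSum, tendsto_iff_norm_sub_tendsto_zero]
    have h3 : Tendsto (fun F : Finset ℕ => √((ν x).real (⋃ i, s i) - ∑ i ∈ F, (ν x).real (s i)))
        atTop (𝓝 0) := by
      have := (tendsto_const_nhds (x := (ν x).real (⋃ i, s i))).sub h1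
      simpa using this.sqrt
    exact h3.congr fun F => (h2 F).symm
  refine ⟨⟨fun s => if MeasurableSet s then P s else 0, fun s hs => if_neg hs, ?_, ?_, ?_⟩, ?_⟩
  · intro s hs
    rw [if_pos hs]
    exact ⟨hidem s hs, ContinuousLinearMap.isSelfAdjoint_iff'.2 (hadj s hs)⟩
  · rw [if_pos MeasurableSet.univ, huniv]
  · intro s hs hd x
    simp only [hs, MeasurableSet.iUnion hs, if_true]
    exact hsum s hs hd x
  · intro x
    ext s hs
    rw [ProjectionMeasure.scalarMeasure_apply _ _ hs]
    simp only [hs, if_true]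
    rw [hnorm s hs, Measure.real, ENNReal.ofReal_toReal (measure_ne_top _ _)]

variable {X : Type*} [TopologicalSpace X] [CompactSpace X] [T2Space X] [MeasurableSpace X]
  [BorelSpace X]

open CompactlySupported in
/-- The Riesz–Markov–Kakutani theorem applied to the positive functional `g ↦ ⟨x, Ψ(g) x⟩`. -/
theorem exists_measure_of_starAlgHom (Ψ : C(X, ℂ) →⋆ₐ[ℂ] (H →L[ℂ] H)) (x : H) :
    ∃ μ : Measure X, IsFiniteMeasure μ ∧ ∀ g : C(X, ℂ), ⟪x, Ψ g x⟫_ℂ = ∫ t, g t ∂μ := by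
  let c : C(X, ℝ) → C(X, ℂ) := fun f => ⟨fun t => (f t : ℂ), by fun_prop⟩
  have hcstar : ∀ f, star (c f) = c f := fun f => by ext t; simp [c]
  let Λ₀ : C_c(X, ℝ) →ₗ[ℝ] ℝ :=
    { toFun := fun f => (⟪x, Ψ (c f.toContinuousMap) x⟫_ℂ).re
      map_add' := by
        intro f g
        have : c (f + g).toContinuousMap = c f.toContinuousMap + c g.toContinuousMap := by
          ext t; simp [c]
        rw [this, map_add, add_apply, inner_add_right, Complex.add_re]
      map_smul' := by
        intro r f
        have : c (r • f).toContinuousMap = (r : ℂ) • c f.toContinuousMap := by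
          ext t; simp [c]
        rw [this, map_smul, smul_apply, inner_smul_right]
        simp }
  have hpos : ∀ f, 0 ≤ f → 0 ≤ Λ₀ f := by
    intro f hf
    let s : C(X, ℝ) := ⟨fun t => √(f t), by fun_prop⟩
    have h1 : c f.toContinuousMap = star (c s) * c s := by
      rw [hcstar]
      ext t
      have : (f t : ℂ) = (√(f t) : ℂ) * (√(f t) : ℂ) := by
        rw [← Complex.ofReal_mul, Real.mul_self_sqrt (hf t)]
      simpa [c, s] using this
    change 0 ≤ (⟪x, Ψ (c f.toContinuousMap) x⟫_ℂ).re
    rw [h1, map_mul, map_star, ContinuousLinearMap.star_eq_adjoint, mul_apply_eq_comp,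
      ContinuousLinearMap.adjoint_inner_right]
    exact inner_self_nonneg (𝕜 := ℂ)
  let Λ : C_c(X, ℝ) →ₚ[ℝ] ℝ := PositiveLinearMap.mk₀ Λ₀ hpos
  refine ⟨RealRMK.rieszMeasure Λ, inferInstance, fun g => ?_⟩
  have hint : Integrable g (RealRMK.rieszMeasure Λ) :=
    g.continuous.integrable_of_hasCompactSupport (HasCompactSupport.of_compactSpace g)
  have hreal : ∀ f : C(X, ℝ), ⟪x, Ψ (c f) x⟫_ℂ = ((∫ t, f t ∂(RealRMK.rieszMeasure Λ) : ℝ) : ℂ) := by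
    intro f
    have h1 := RealRMK.integral_rieszMeasure Λ
      (CompactlySupportedContinuousMap.continuousMapEquiv f)
    have h2 : ∫ t, f t ∂(RealRMK.rieszMeasure Λ) = (⟪x, Ψ (c f) x⟫_ℂ).re := h1
    rw [h2]
    have h3 : (starRingEnd ℂ) ⟪x, Ψ (c f) x⟫_ℂ = ⟪x, Ψ (c f) x⟫_ℂ := by
      rw [inner_conj_symm, ← ContinuousLinearMap.adjoint_inner_right,
        ← ContinuousLinearMap.star_eq_adjoint, ← map_star, hcstar]
    exact (Complex.conj_eq_iff_re.1 h3).symm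
  let gr : C(X, ℝ) := ⟨fun t => (g t).re, by fun_prop⟩
  let gi : C(X, ℝ) := ⟨fun t => (g t).im, by fun_prop⟩
  have hg : g = c gr + Complex.I • c gi := by
    ext t
    simp [c, gr, gi, mul_comm Complex.I, Complex.re_add_im]
  have h1 : Ψ g = Ψ (c gr) + Complex.I • Ψ (c gi) := by
    rw [← map_smul, ← map_add, ← hg]
  rw [h1, add_apply, smul_apply, inner_add_right, inner_smul_right, hreal, hreal,
    ← integral_re_add_im hint, mul_comm Complex.I]
  rfl

/-- A representation of `C(X)` on a Hilbert space extends to bounded Borel functions, with the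
scalar measures given by the Riesz–Markov–Kakutani theorem. -/
theorem exists_borel_calculus_of_starAlgHom [TopologicalSpace.PseudoMetrizableSpace X]
    (Ψ : C(X, ℂ) →⋆ₐ[ℂ] (H →L[ℂ] H)) :
    ∃ μ : H → Measure X, (∀ x, μ x Set.univ = ENNReal.ofReal (‖x‖ ^ 2)) ∧
      (∀ (g : C(X, ℂ)) (x : H), ⟪x, Ψ g x⟫_ℂ = ∫ t, g t ∂μ x) ∧
      ∀ {φ : X → ℂ}, BddMeasurable φ → ∃ G : H →L[ℂ] H, ∀ x,
        ⟪x, G x⟫_ℂ = ∫ t, φ t ∂μ x ∧ ‖G x‖ ^ 2 = ∫ t, ‖φ t‖ ^ 2 ∂μ x := by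
  choose μ hfin hμ using fun x => exists_measure_of_starAlgHom Ψ x
  have huniv : ∀ x, μ x Set.univ = ENNReal.ofReal (‖x‖ ^ 2) := by
    intro x
    have h1 := hμ x 1
    rw [map_one, one_apply_eq_self, inner_self_eq_norm_sq_to_K] at h1
    have h2 : ‖x‖ ^ 2 = (μ x).real Set.univ := by
      have : ((‖x‖ ^ 2 : ℝ) : ℂ) = ((μ x).real Set.univ : ℝ) := by simpa using h1
      exact_mod_cast this
    rw [h2, Measure.real, ENNReal.ofReal_toReal (measure_ne_top _ _)]
  have hbdd : ∀ g : C(X, ℂ), BddMeasurable g := fun g =>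
    ⟨g.continuous.measurable, ‖g‖, g.norm_coe_le_norm⟩
  refine ⟨μ, huniv, fun g x => hμ x g, fun {φ} hφ => ?_⟩
  refine exists_operator_of_dense μ huniv (fun g : C(X, ℂ) => (g : X → ℂ)) Ψ hbdd ?_ ?_
    (fun g x => hμ x g) ?_ hφ
  · intro g k
    exact ⟨g - k, rfl, map_sub Ψ g k⟩
  · intro g x
    have h1 : ⟪x, Ψ (star g * g) x⟫_ℂ = ((‖Ψ g x‖ ^ 2 : ℝ) : ℂ) := by
      rw [map_mul, map_star, ContinuousLinearMap.star_eq_adjoint, mul_apply_eq_comp,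
        ContinuousLinearMap.adjoint_inner_right, inner_self_eq_norm_sq_to_K]
      norm_cast
    rw [hμ] at h1
    have h2 : ∀ t, (star g * g) t = ((‖g t‖ ^ 2 : ℝ) : ℂ) := by
      intro t
      have := Complex.conj_mul' (g t)
      simpa using this
    simp_rw [h2] at h1
    rw [integral_complex_ofReal] at h1
    exact_mod_cast h1.symm
  · intro ν _ ψ hψ ε hε
    obtain ⟨g, hg, -⟩ := hψ.exists_boundedContinuous_eLpNorm_sub_le ENNReal.ofNat_ne_top hε
    exact ⟨g.toContinuousMap, hg⟩

end Construction

/-! ### Existence of the spectral measure -/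

section SpectralTheorem

variable {H : Type*} [NormedAddCommGroup H] [InnerProductSpace ℂ H] [CompleteSpace H]

namespace LinearPMap.IsResolvent

variable {T : H →ₗ.[ℂ] H} {z : ℂ} {R S : H →L[ℂ] H}

theorem adjoint_eq (hT : IsSelfAdjoint T) (hR : T.IsResolvent z R)
    (hS : T.IsResolvent ((starRingEnd ℂ) z) S) : ContinuousLinearMap.adjoint R = S := by
  ext v
  refine ext_inner_left ℂ fun u => ?_
  rw [ContinuousLinearMap.adjoint_inner_right]
  obtain ⟨h, e⟩ := hR.2 u
  obtain ⟨k, d⟩ := hS.2 v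
  have h1 := LinearPMap.inner_apply_eq_of_isSelfAdjoint hT ⟨R u, h⟩ ⟨S v, k⟩
  simp only at h1
  conv_lhs => rw [← d]
  conv_rhs => rw [← e]
  rw [inner_sub_right, inner_sub_left, h1, inner_smul_left, inner_smul_right]

theorem dense_range (hT : IsSelfAdjoint T) (hR : T.IsResolvent z R) : DenseRange R := by
  refine hT.dense_domain.mono fun x hx => ?_
  exact ⟨_, hR.1 ⟨x, hx⟩⟩

end LinearPMap.IsResolvent

/-- The spectral theorem for unbounded self-adjoint operators. The Borel calculus of the bounded
normal operator `R = (T - i)⁻¹` is transported to `ℝ` by the inverse of `t ↦ (t - i)⁻¹`; the point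
`0` of the spectrum of `R`, which corresponds to `t = ∞`, carries no mass. -/
theorem LinearPMap.exists_isSpectralMeasureOf {T : H →ₗ.[ℂ] H} (hT : IsSelfAdjoint T) :
    ∃ E : ProjectionMeasure H, E.IsSpectralMeasureOf T := by
  have hI : Complex.I.im ≠ 0 := by simp
  obtain ⟨R, hR⟩ : ∃ R, T.IsResolvent Complex.I R :=
    LinearPMap.mem_resolventPoints_of_im_ne_zero hT hI
  obtain ⟨S, hS⟩ : ∃ S, T.IsResolvent ((starRingEnd ℂ) Complex.I) S :=
    LinearPMap.mem_resolventPoints_of_im_ne_zero hT (by simp)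
  have hadj : star R = S := hR.adjoint_eq hT hS
  have hRS : R - S = (2 * Complex.I) • (R * S) := by
    rw [hR.sub_eq hS, Complex.conj_I]
    congr 1
    ring
  have hSR : R - S = (2 * Complex.I) • (S * R) := by
    rw [← neg_sub, hS.sub_eq hR, Complex.conj_I, ← neg_smul]
    congr 1
    ring
  have hnormal : IsStarNormal R := by
    refine ⟨?_⟩
    rw [hadj]
    exact smul_right_injective _ (show (2 * Complex.I) ≠ 0 by simp) (hSR.symm.trans hRS)
  let id' : C(spectrum ℂ R, ℂ) := ContinuousMap.restrict (spectrum ℂ R) (ContinuousMap.id ℂ)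
  let Ψ := cfcHom (R := ℂ) hnormal
  have hid : Ψ id' = R := cfcHom_id hnormal
  -- The resolvent identity forces the spectrum of `R` onto the circle `im w = |w| ^ 2`.
  have hcircle : ∀ w : spectrum ℂ R, (w : ℂ) - (starRingEnd ℂ) (w : ℂ) =
      2 * Complex.I * ((starRingEnd ℂ) (w : ℂ) * w) := by
    have h1 : id' - star id' = (2 * Complex.I) • (star id' * id') := by
      refine (cfcHom_isClosedEmbedding hnormal).injective ?_
      change Ψ _ = Ψ _
      rw [_root_.map_sub, _root_.map_smul, map_mul, map_star, hid, hadj, hSR]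
    intro w
    have := congrArg (fun g : C(spectrum ℂ R, ℂ) => g w) h1
    simpa [id'] using this
  obtain ⟨μ, huniv, hμ, hcalc⟩ := exists_borel_calculus_of_starAlgHom Ψ
  have hfin : ∀ x, IsFiniteMeasure (μ x) := fun x => ⟨by rw [huniv]; exact ENNReal.ofReal_lt_top⟩
  let N : Set (spectrum ℂ R) := {w | (w : ℂ) = 0}
  have hN : MeasurableSet N := measurable_subtype_coe (measurableSet_singleton 0)
  -- No mass sits at `0`: this holds on the dense range of `R`, and the mass is continuous in `x`.
  have hzero_range : ∀ y, (μ (R y)).real N = 0 := by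
    intro y
    -- Compare the indicator of `N` with the tent function `max 0 (1 - (n + 1) * ‖w‖)`, using
    -- `d(μ (R y)) = ‖w‖ ^ 2 d(μ y)`.
    have hle : ∀ n : ℕ, (μ (R y)).real N ≤ ‖y‖ ^ 2 * (((n : ℝ) + 1)⁻¹) ^ 2 := by
      intro n
      let r : C(spectrum ℂ R, ℝ) := ⟨fun w => max 0 (1 - (n + 1) * ‖(w : ℂ)‖), by fun_prop⟩
      let g : C(spectrum ℂ R, ℂ) := ⟨fun w => (r w : ℂ), by fun_prop⟩
      have hr0 : ∀ w, 0 ≤ r w := fun w => le_max_left _ _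
      have h1 : ⟪R y, Ψ g (R y)⟫_ℂ = ⟪y, Ψ (star id' * g * id') y⟫_ℂ := by
        rw [map_mul, map_mul, map_star, hid, mul_apply_eq_comp, mul_apply_eq_comp,
          ContinuousLinearMap.star_eq_adjoint, ContinuousLinearMap.adjoint_inner_right]
      rw [hμ, hμ] at h1
      have h2 : ∀ w, (star id' * g * id') w = ((r w * ‖(w : ℂ)‖ ^ 2 : ℝ) : ℂ) := by
        intro w
        have h3 := Complex.conj_mul' (w : ℂ)
        have h4 : (star id' * g * id') w = (starRingEnd ℂ) (w : ℂ) * r w * w := rfl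
        rw [h4]
        push_cast
        rw [← h3]
        ring
      simp_rw [h2] at h1
      rw [show (fun w => g w) = fun w => ((r w : ℝ) : ℂ) from rfl, integral_complex_ofReal,
        integral_complex_ofReal, Complex.ofReal_inj] at h1
      have hri : Integrable r (μ (R y)) :=
        r.continuous.integrable_of_hasCompactSupport (HasCompactSupport.of_compactSpace r)
      have hri' : Integrable (fun w => r w * ‖(w : ℂ)‖ ^ 2) (μ y) :=
        Continuous.integrable_of_hasCompactSupport (by fun_prop)
          (HasCompactSupport.of_compactSpace _)
      calc (μ (R y)).real N = ∫ w, N.indicator (fun _ => (1 : ℝ)) w ∂(μ (R y)) := by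
            rw [integral_indicator_const _ hN, smul_eq_mul, mul_one]
        _ ≤ ∫ w, r w ∂(μ (R y)) := by
            refine integral_mono ((integrable_const 1).indicator hN) hri fun w => ?_
            by_cases hw : w ∈ N
            · have hw' : (w : ℂ) = 0 := hw
              simp [hw, r, hw']
            · simpa [hw] using hr0 w
        _ = ∫ w, r w * ‖(w : ℂ)‖ ^ 2 ∂(μ y) := h1
        _ ≤ ∫ w, (((n : ℝ) + 1)⁻¹) ^ 2 ∂(μ y) := by
            refine integral_mono hri' (integrable_const _) fun w => ?_
            have hn : (0 : ℝ) < n + 1 := by positivity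
            by_cases hw : ((n : ℝ) + 1) * ‖(w : ℂ)‖ ≤ 1
            · have h5 : ‖(w : ℂ)‖ ≤ ((n : ℝ) + 1)⁻¹ := by
                rw [← one_div, le_div_iff₀ hn, mul_comm]; exact hw
              have h6 : r w ≤ 1 := max_le zero_le_one (by
                have : 0 ≤ ((n : ℝ) + 1) * ‖(w : ℂ)‖ := by positivity
                linarith)
              calc r w * ‖(w : ℂ)‖ ^ 2 ≤ 1 * (((n : ℝ) + 1)⁻¹) ^ 2 :=
                    mul_le_mul h6 (pow_le_pow_left₀ (norm_nonneg _) h5 2) (by positivity) zero_le_one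
                _ = _ := one_mul _
            · have h6 : r w = 0 := max_eq_left (by push Not at hw; linarith)
              simp only [h6, zero_mul]
              positivity
        _ = ‖y‖ ^ 2 * (((n : ℝ) + 1)⁻¹) ^ 2 := by
            rw [integral_const, Measure.real, huniv, ENNReal.toReal_ofReal (by positivity),
              smul_eq_mul]
    have hlim : Tendsto (fun n : ℕ => ‖y‖ ^ 2 * (((n : ℝ) + 1)⁻¹) ^ 2) atTop (𝓝 0) := by
      have h1 : Tendsto (fun n : ℕ => ((n : ℝ) + 1)⁻¹) atTop (𝓝 0) := by
        simpa only [one_div] using tendsto_one_div_add_atTop_nhds_zero_nat (𝕜 := ℝ)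
      simpa using (h1.pow 2).const_mul (‖y‖ ^ 2)
    exact le_antisymm (ge_of_tendsto' hlim hle) measureReal_nonneg
  have hzero : ∀ x, μ x N = 0 := by
    obtain ⟨G, hG⟩ := hcalc (BddMeasurable.indicator_one hN)
    have hG' : ∀ x, ⟪x, G x⟫_ℂ = ((μ x).real N : ℂ) := by
      intro x
      rw [(hG x).1, integral_indicator_const _ hN]
      simp
    have h1 : (fun x => ⟪x, G x⟫_ℂ) = fun _ => 0 := by
      refine Continuous.ext_on (hR.dense_range hT) (by fun_prop) continuous_const ?_
      rintro _ ⟨y, rfl⟩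
      simp only
      rw [hG', hzero_range, Complex.ofReal_zero]
    intro x
    have h2 : ⟪x, G x⟫_ℂ = 0 := congrFun h1 x
    rw [hG', Complex.ofReal_eq_zero] at h2
    exact (measureReal_eq_zero_iff).1 h2
  -- The inverse of `t ↦ (t - i)⁻¹`.
  let h : spectrum ℂ R → ℝ := fun w => ((w : ℂ)⁻¹).re
  have hh : Measurable h := by
    have : Measurable fun w : spectrum ℂ R => ((w : ℂ)⁻¹) := measurable_subtype_coe.inv
    exact Complex.measurable_re.comp this
  have hinv : ∀ w : spectrum ℂ R, w ∉ N → ((h w : ℂ) - Complex.I)⁻¹ = w := by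
    intro w hw
    have hw0 : (w : ℂ) ≠ 0 := hw
    have hc0 : (starRingEnd ℂ) (w : ℂ) ≠ 0 := (map_ne_zero _).2 hw0
    have h1 := hcircle w
    have h2 : (h w : ℂ) = (w : ℂ)⁻¹ + Complex.I := by
      have h3 : (h w : ℂ) = ((w : ℂ)⁻¹ + (starRingEnd ℂ) ((w : ℂ)⁻¹)) / 2 := by
        rw [Complex.add_conj]
        simp [h]
      rw [h3, map_inv₀]
      field_simp
      linear_combination h1
    rw [h2, add_sub_cancel_right, inv_inv]
  obtain ⟨E, hE⟩ := ProjectionMeasure.exists_of_scalarMeasures (fun x => (μ x).map h)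
    (fun x => by rw [Measure.map_apply hh MeasurableSet.univ, Set.preimage_univ, huniv])
    (fun s hs => by
      obtain ⟨G, hG⟩ := hcalc (BddMeasurable.indicator_one (hh hs))
      refine ⟨G, fun x => ?_⟩
      rw [map_measureReal_apply hh hs, (hG x).1, (hG x).2]
      refine ⟨?_, ?_⟩
      · rw [integral_indicator_const _ (hh hs)]
        simp
      · have : ∀ w, ‖(h ⁻¹' s).indicator (fun _ => (1 : ℂ)) w‖ ^ 2 =
            (h ⁻¹' s).indicator (fun _ => (1 : ℝ)) w := by
          intro w
          by_cases hw : w ∈ h ⁻¹' s <;> simp [hw]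
        simp_rw [this]
        rw [integral_indicator_const _ (hh hs), smul_eq_mul, mul_one])
  have hRE : R = E.integral fun t => ((t : ℂ) - Complex.I)⁻¹ := by
    refine E.eq_integral (bddMeasurable_inv_sub hI) fun x => ?_
    rw [hE, integral_map hh.aemeasurable (by
      exact (bddMeasurable_inv_sub hI).1.aestronglyMeasurable)]
    have hx : ⟪x, R x⟫_ℂ = ∫ w, id' w ∂μ x := by rw [← hμ, hid]
    rw [hx]
    refine integral_congr_ae ?_
    filter_upwards [measure_eq_zero_iff_ae_notMem.1 (hzero x)] with w hw
    exact (hinv w hw).symm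
  exact ⟨E, E.isSpectralMeasureOf_of_resolvent hI (hRE ▸ hR)⟩

end SpectralTheorem

/-! ### Supports of spectral measures and the norm of `(T - z)⁻¹ V` -/

section SpectralSupport

variable {H K : Type*} [NormedAddCommGroup H] [InnerProductSpace ℂ H] [CompleteSpace H]
  [NormedAddCommGroup K] [InnerProductSpace ℂ K] [CompleteSpace K]

namespace ProjectionMeasure

variable (E : ProjectionMeasure H) (V : K →L[ℂ] H)

theorem isClosed_compressedSupport : IsClosed (E.compressedSupport V) := by
  rw [← isOpen_compl_iff, isOpen_iff_forall_mem_open]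
  intro t ht
  simp only [compressedSupport, Set.mem_compl_iff, Set.mem_ofPred_eq, not_forall] at ht
  obtain ⟨U, hU, htU, h0⟩ := ht
  exact ⟨U, fun s hs h => h0 (h U hU hs), hU, htU⟩

theorem scalarMeasure_compl_compressedSupport (x : K) :
    E.scalarMeasure (V x) (E.compressedSupport V)ᶜ = 0 := by
  refine measure_null_of_locally_null _ fun t ht => ?_
  simp only [compressedSupport, Set.mem_compl_iff, Set.mem_ofPred_eq, not_forall] at ht
  obtain ⟨U, hU, htU, h0⟩ := ht
  refine ⟨U, mem_nhdsWithin_of_mem_nhds (hU.mem_nhds htU), ?_⟩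
  have h1 := congrArg (fun F : K →L[ℂ] K => ⟪x, F x⟫_ℂ) (not_not.1 h0)
  simp only [ContinuousLinearMap.comp_apply, ContinuousLinearMap.adjoint_inner_right,
    zero_apply, inner_zero_right, E.inner_proj_self hU.measurableSet, Complex.ofReal_eq_zero] at h1
  exact (measureReal_eq_zero_iff).1 h1

theorem compressedSupport_subset :
    E.compressedSupport V ⊆ E.compressedSupport (ContinuousLinearMap.id ℂ H) := by
  intro t ht U hU htU h0
  refine ht U hU htU ?_
  have h1 : E.proj U = 0 := by
    refine ContinuousLinearMap.eq_of_inner_self fun x => ?_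
    have h2 := congrArg (fun F : H →L[ℂ] H => ⟪x, F x⟫_ℂ) h0
    simpa only [ContinuousLinearMap.comp_apply, ContinuousLinearMap.adjoint_inner_right,
      ContinuousLinearMap.id_apply] using h2
  rw [h1, ContinuousLinearMap.zero_comp, ContinuousLinearMap.comp_zero]

variable {E} in
/-- On the range of `E(s)`, for bounded `s`, the operator `T - t₀` acts as `∫_s (t - t₀) dE`. -/
theorem IsSpectralMeasureOf.proj_mem_domain {T : H →ₗ.[ℂ] H} (hE : E.IsSpectralMeasureOf T)
    {s : Set ℝ} (hs : MeasurableSet s) (hb : Bornology.IsBounded s) (t₀ : ℝ) (x : H) :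
    BddMeasurable (s.indicator fun t => (t : ℂ) - t₀) ∧ ∃ h : E.proj s x ∈ T.domain,
      T ⟨E.proj s x, h⟩ - (t₀ : ℂ) • E.proj s x =
        E.integral (s.indicator fun t => (t : ℂ) - t₀) x := by
  have hI : Complex.I.im ≠ 0 := by simp
  obtain ⟨C, hC⟩ := hb.exists_norm_le
  have hbdd : ∀ z : ℂ, BddMeasurable (s.indicator fun t : ℝ => (t : ℂ) - z) := by
    intro z
    refine ⟨Measurable.indicator (by fun_prop) hs, |C| + ‖z‖, fun t => ?_⟩
    by_cases ht : t ∈ s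
    · rw [Set.indicator_of_mem ht]
      refine (norm_sub_le _ _).trans (add_le_add ?_ le_rfl)
      rw [Complex.norm_real]
      exact (hC t ht).trans (le_abs_self C)
    · rw [Set.indicator_of_notMem ht, norm_zero]
      positivity
  refine ⟨hbdd t₀, ?_⟩
  have h1 : E.integral (fun t => ((t : ℂ) - Complex.I)⁻¹)
      (E.integral (s.indicator fun t => (t : ℂ) - Complex.I) x) = E.proj s x := by
    rw [← E.integral_mul (bddMeasurable_inv_sub hI) (hbdd _), ← E.integral_indicator_one hs]
    congr 2
    ext t
    by_cases ht : t ∈ s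
    · simp [ht, inv_mul_cancel₀ (sub_ofReal_ne_zero hI t)]
    · simp [ht]
  have h2 := hE.apply_integral_inv_sub hI (E.integral (s.indicator fun t => (t : ℂ) - Complex.I) x)
  rw [h1] at h2
  obtain ⟨h, h3⟩ := h2
  refine ⟨h, ?_⟩
  have h4 : (s.indicator fun t : ℝ => (t : ℂ) - t₀) = fun t =>
      (s.indicator fun t : ℝ => (t : ℂ) - Complex.I) t +
        (Complex.I - t₀) * (s.indicator fun _ : ℝ => (1 : ℂ)) t := by
    ext t
    by_cases ht : t ∈ s <;> simp [ht]
  rw [h4, E.integral_add (hbdd _) ((BddMeasurable.indicator_one hs).const_mul _),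
    E.integral_const_mul _ (BddMeasurable.indicator_one hs), E.integral_indicator_one hs, add_apply,
    smul_apply, ← h3, sub_smul]
  abel

variable {E} in
/-- A real point with a bounded resolvent has a neighbourhood of measure zero, since `T - t₀` is
small on the range of `E(U)` when `U` is a small neighbourhood of `t₀`. -/
theorem IsSpectralMeasureOf.compressedSupport_id_subset {T : H →ₗ.[ℂ] H}
    (hE : E.IsSpectralMeasureOf T) :
    E.compressedSupport (ContinuousLinearMap.id ℂ H) ⊆ T.realSpectrum := by
  intro t₀ ht₀ hres
  obtain ⟨R, hR, -⟩ := hres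
  have hδ : 0 < (‖R‖ + 1)⁻¹ := by positivity
  refine ht₀ (Metric.ball t₀ (‖R‖ + 1)⁻¹) Metric.isOpen_ball (Metric.mem_ball_self hδ) ?_
  have hU : MeasurableSet (Metric.ball t₀ (‖R‖ + 1)⁻¹) := measurableSet_ball
  have h0 : E.proj (Metric.ball t₀ (‖R‖ + 1)⁻¹) = 0 := by
    ext x
    set U := Metric.ball t₀ (‖R‖ + 1)⁻¹ with hUdef
    obtain ⟨hb, h, h1⟩ := hE.proj_mem_domain hU Metric.isBounded_ball t₀ x
    have h2 := hR ⟨E.proj U x, h⟩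
    have h3 : ‖E.integral (U.indicator fun t => (t : ℂ) - t₀) x‖ ≤
        (‖R‖ + 1)⁻¹ * ‖E.proj U x‖ := by
      refine abs_le_of_sq_le_sq' ?_ (by positivity) |>.2
      rw [E.norm_sq_integral hb, mul_pow, ← E.integral_indicator_one hU,
        E.norm_sq_integral (BddMeasurable.indicator_one hU), ← MeasureTheory.integral_const_mul]
      refine integral_mono (hb.integrable_norm_sq _)
        (((BddMeasurable.indicator_one hU).integrable_norm_sq _).const_mul _) fun t => ?_
      by_cases ht : t ∈ U
      · have h4 : ‖(t : ℂ) - t₀‖ ≤ (‖R‖ + 1)⁻¹ := by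
          rw [← Complex.ofReal_sub, Complex.norm_real, ← dist_eq_norm]
          exact (Metric.mem_ball.1 ht).le
        simp only [Set.indicator_of_mem ht, norm_one, one_pow, mul_one]
        exact pow_le_pow_left₀ (norm_nonneg _) h4 2
      · simp [ht]
    simp only at h2
    rw [h1] at h2
    have h5 : ‖E.proj U x‖ ≤ ‖R‖ * ((‖R‖ + 1)⁻¹ * ‖E.proj U x‖) := by
      calc ‖E.proj U x‖ = ‖R (E.integral (U.indicator fun t => (t : ℂ) - t₀) x)‖ := by rw [h2]
        _ ≤ ‖R‖ * ‖E.integral (U.indicator fun t => (t : ℂ) - t₀) x‖ := R.le_opNorm _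
        _ ≤ _ := mul_le_mul_of_nonneg_left h3 (norm_nonneg _)
    have h6 : ‖R‖ * (‖R‖ + 1)⁻¹ = 1 - (‖R‖ + 1)⁻¹ := by
      field_simp
      ring
    rw [← mul_assoc, h6] at h5
    have h7 : ‖E.proj U x‖ ≤ 0 := by
      by_contra hc
      push Not at hc
      nlinarith [mul_pos hδ hc]
    exact norm_le_zero_iff.1 h7
  rw [h0, ContinuousLinearMap.zero_comp, ContinuousLinearMap.comp_zero]

end ProjectionMeasure

namespace LinearPMap

variable {T : H →ₗ.[ℂ] H}

theorem spectralMeasure_spec (hT : IsSelfAdjoint T) :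
    T.spectralMeasure.IsSpectralMeasureOf T :=
  Classical.epsilon_spec (exists_isSpectralMeasureOf hT)

theorem isResolvent_integral (hT : IsSelfAdjoint T) {z : ℂ} (hz : z.im ≠ 0) :
    T.IsResolvent z (T.spectralMeasure.integral fun t => ((t : ℂ) - z)⁻¹) := by
  have h2 := fun y => (spectralMeasure_spec hT).apply_integral_inv_sub hz y
  refine ⟨fun x => ?_, h2⟩
  obtain ⟨R, hR, -⟩ := mem_resolventPoints_of_im_ne_zero hT hz
  obtain ⟨h, e⟩ := h2 (T x - z • (x : H))
  have h3 := hR ⟨_, h⟩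
  simp only at h3
  rw [← h3, e, hR]

/-- The operator `f(T)` is the integral of a positive bounded Borel function `φ` on the whole line
that agrees with `f` on the support of the spectral measure. -/
theorem exists_functionOf_eq_integral (hT : IsSelfAdjoint T) {f : ℝ → ℝ}
    (hf : f ∈ CPlus T.realSpectrum) : ∃ φ : ℝ → ℝ, BddMeasurable (fun t => (φ t : ℂ)) ∧
      (∀ t, 0 < φ t) ∧
      (∀ t ∈ T.spectralMeasure.compressedSupport (ContinuousLinearMap.id ℂ H), φ t = f t) ∧
      functionOf f T = T.spectralMeasure.integral fun t => (φ t : ℂ) := by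
  classical
  set E := T.spectralMeasure with hE
  set S := E.compressedSupport (ContinuousLinearMap.id ℂ H) with hS
  have hSσ : S ⊆ T.realSpectrum := (spectralMeasure_spec hT).compressedSupport_id_subset
  obtain ⟨hcont, hpos, ⟨C, hC⟩, -⟩ := hf
  have hSm : MeasurableSet S := (E.isClosed_compressedSupport _).measurableSet
  have hφ : BddMeasurable fun t => (S.piecewise f 1 t : ℂ) := by
    refine ⟨Complex.measurable_ofReal.comp ((hcont.mono hSσ).measurable_piecewise
      continuousOn_const hSm), max C 1, fun t => ?_⟩
    rw [Complex.norm_real]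
    by_cases ht : t ∈ S
    · rw [Set.piecewise_eq_of_mem _ _ _ ht, Real.norm_of_nonneg (hpos t (hSσ ht)).le]
      exact (hC ⟨t, hSσ ht, rfl⟩).trans (le_max_left _ _)
    · rw [Set.piecewise_eq_of_notMem _ _ _ ht]
      simp
  -- The value `1` off the support only serves to make the function positive everywhere.
  refine ⟨S.piecewise f 1, hφ, fun t => ?_, fun t ht => Set.piecewise_eq_of_mem _ _ _ ht, ?_⟩
  · by_cases ht : t ∈ S
    · rw [Set.piecewise_eq_of_mem _ _ _ ht]
      exact hpos t (hSσ ht)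
    · rw [Set.piecewise_eq_of_notMem _ _ _ ht]
      exact one_pos
  · have hae : ∀ x, ∀ᵐ t ∂E.scalarMeasure x, t ∈ S := fun x =>
      E.scalarMeasure_compl_compressedSupport (ContinuousLinearMap.id ℂ H) x
    have hint : ∀ x, ∫ t, (S.piecewise f 1 t : ℂ) ∂E.scalarMeasure x =
        ((∫ t in T.realSpectrum, f t ∂E.scalarMeasure x : ℝ) : ℂ) := by
      intro x
      rw [Measure.restrict_eq_self_of_ae_mem ((hae x).mono fun t ht => hSσ ht),
        integral_complex_ofReal, Complex.ofReal_inj]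
      refine integral_congr_ae ((hae x).mono fun t ht => ?_)
      exact Set.piecewise_eq_of_mem _ _ _ ht
    refine E.eq_integral hφ fun x => ?_
    rw [hint]
    exact Classical.epsilon_spec (p := fun F : H →L[ℂ] H => ∀ x : H,
      ⟪x, F x⟫_ℂ = ((∫ t in T.realSpectrum, f t ∂(T.spectralMeasure.scalarMeasure x) : ℝ) : ℂ))
      ⟨E.integral fun t => (S.piecewise f 1 t : ℂ), fun x => by
        rw [E.inner_integral hφ, hint]⟩ x

/-- The assumption says `‖f(T) V‖ ^ 2 * |t - z|⁻² < f(t) ^ 2` on the local spectrum. Integrating this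
against the measure `μ` of `V x` gives `‖(T - z)⁻¹ V x‖ ≤ ‖x‖`, but the gap may close as `|t| → ∞`,
so the inequality is not yet uniform. It becomes so because mass of `μ` near infinity contributes
little to `∫ |t - z|⁻² dμ`. -/
theorem exists_norm_resolvent_comp_lt_one (hT : IsSelfAdjoint T) {f : ℝ → ℝ}
    (hf : f ∈ CPlus T.realSpectrum) (V : K →L[ℂ] H) {z : ℂ} (hz : z.im ≠ 0)
    (h : ∀ t ∈ localSpectrum V T, ‖(functionOf f T).comp V‖ < f t * ‖(t : ℂ) - z‖) :
    ∃ q < 1, ∀ x, ‖T.spectralMeasure.integral (fun t => ((t : ℂ) - z)⁻¹) (V x)‖ ^ 2 ≤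
      q * ‖x‖ ^ 2 := by
  obtain ⟨φ, hφ, hφpos, hφf, hfφ⟩ := exists_functionOf_eq_integral hT hf
  set E := T.spectralMeasure with hE
  set c := ‖(functionOf f T).comp V‖ with hc
  have hbound : ∀ x, ‖E.integral (fun t => (φ t : ℂ)) (V x)‖ ≤ c * ‖x‖ := by
    intro x
    rw [← hfφ]
    exact ((functionOf f T).comp V).le_opNorm x
  rcases eq_or_lt_of_le (show 0 ≤ c from norm_nonneg _) with hc0 | hc0
  · -- If `f(T) V = 0` then `V = 0`, because `f` is positive.
    refine ⟨0, zero_lt_one, fun x => ?_⟩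
    have h1 := hbound x
    rw [← hc0, zero_mul] at h1
    rw [E.integral_injective hφ (fun t => Complex.ofReal_ne_zero.2 (hφpos t).ne')
      (norm_le_zero_iff.1 h1)]
    simp
  have hb := bddMeasurable_inv_sub hz
  set S := localSpectrum V T with hS
  have hSsub : S ⊆ E.compressedSupport (ContinuousLinearMap.id ℂ H) :=
    E.compressedSupport_subset V
  have hScont : ContinuousOn f S := hf.1.mono
    (hSsub.trans (spectralMeasure_spec hT).compressedSupport_id_subset)
  have hae : ∀ x, ∀ᵐ t ∂E.scalarMeasure (V x), t ∈ S := fun x =>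
    E.scalarMeasure_compl_compressedSupport V x
  have hlt : ∀ t ∈ S, 0 < f t ^ 2 - c ^ 2 * ‖((t : ℂ) - z)⁻¹‖ ^ 2 := by
    intro t ht
    have h1 := h t ht
    have h2 : 0 < ‖(t : ℂ) - z‖ := norm_pos_iff.2 (sub_ofReal_ne_zero hz t)
    have h3 : c * ‖((t : ℂ) - z)⁻¹‖ < f t := by
      rw [norm_inv, ← div_eq_mul_inv, div_lt_iff₀ h2]
      exact h1
    have h4 : (c * ‖((t : ℂ) - z)⁻¹‖) ^ 2 < f t ^ 2 :=
      pow_lt_pow_left₀ h3 (by positivity) two_ne_zero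
    rw [mul_pow] at h4
    linarith
  -- Outside `[-r, r]` the function `‖(t - z)⁻¹‖ ^ 2` is at most `(2 * (‖V‖ + 1))⁻¹ ^ 2`.
  set r := ‖z‖ + 2 * (‖V‖ + 1) with hr
  set J := Set.Icc (-r) r with hJ
  have hJm : MeasurableSet J := measurableSet_Icc
  obtain ⟨δ, hδ, hδle⟩ : ∃ δ, 0 < δ ∧ ∀ t ∈ S ∩ J,
      δ ≤ f t ^ 2 - c ^ 2 * ‖((t : ℂ) - z)⁻¹‖ ^ 2 := by
    refine IsCompact.exists_forall_le' (isCompact_Icc.inter_left (E.isClosed_compressedSupport V))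
      ?_ fun t ht => hlt t ht.1
    refine ((hScont.mono Set.inter_subset_left).pow 2).sub (Continuous.continuousOn ?_)
    refine continuous_const.mul (Continuous.pow (Continuous.norm ?_) 2)
    exact Continuous.inv₀ (by fun_prop) (sub_ofReal_ne_zero hz)
  set C₀ := (|z.im|⁻¹) ^ 2 with hC₀
  have hC₀pos : 0 < C₀ := by
    have := abs_pos.2 hz
    positivity
  have hden : 0 < C₀ * c ^ 2 + δ := by positivity
  refine ⟨(C₀ * c ^ 2 + δ / 4) / (C₀ * c ^ 2 + δ), by rw [div_lt_one hden]; linarith, fun x => ?_⟩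
  set μ := E.scalarMeasure (V x) with hμ
  set X := ‖E.integral (fun t => ((t : ℂ) - z)⁻¹) (V x)‖ ^ 2 with hX
  have hXint : X = ∫ t, ‖((t : ℂ) - z)⁻¹‖ ^ 2 ∂μ := E.norm_sq_integral hb _
  have hJint : ∀ a : ℝ, ∫ t, J.indicator (fun _ => a) t ∂μ = μ.real J * a := fun a => by
    rw [integral_indicator_const _ hJm, smul_eq_mul]
  have hJi : ∀ a : ℝ, Integrable (J.indicator fun _ => a) μ := fun a =>
    (integrable_const a).indicator hJm
  -- The mass of `[-r, r]` creates a gap in the first bound, its absence one in the second.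
  have h1 : c ^ 2 * X ≤ c ^ 2 * ‖x‖ ^ 2 - μ.real J * δ := by
    have h2 : ∫ t, ‖(φ t : ℂ)‖ ^ 2 ∂μ ≤ c ^ 2 * ‖x‖ ^ 2 := by
      rw [← E.norm_sq_integral hφ, ← mul_pow]
      exact pow_le_pow_left₀ (norm_nonneg _) (hbound x) 2
    have h3 : c ^ 2 * X ≤ ∫ t, (‖(φ t : ℂ)‖ ^ 2 - J.indicator (fun _ => δ) t) ∂μ := by
      rw [hXint, ← MeasureTheory.integral_const_mul]
      refine integral_mono_ae ((hb.integrable_norm_sq _).const_mul _)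
        ((hφ.integrable_norm_sq _).sub (hJi δ)) ((hae x).mono fun t ht => ?_)
      simp only
      rw [Complex.norm_real, Real.norm_eq_abs, sq_abs, hφf t (hSsub ht)]
      by_cases htJ : t ∈ J
      · rw [Set.indicator_of_mem htJ]
        linarith [hδle t ⟨ht, htJ⟩]
      · rw [Set.indicator_of_notMem htJ]
        linarith [hlt t ht]
    rw [MeasureTheory.integral_sub (hφ.integrable_norm_sq _) (hJi δ), hJint] at h3
    linarith
  have h2 : X ≤ μ.real J * C₀ + ‖x‖ ^ 2 / 4 := by
    set η := ((2 * (‖V‖ + 1))⁻¹) ^ 2 with hη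
    have h3 : X ≤ ∫ t, (J.indicator (fun _ => C₀) t + η) ∂μ := by
      rw [hXint]
      refine integral_mono (hb.integrable_norm_sq _) ((hJi C₀).add (integrable_const η))
        fun t => ?_
      simp only
      rw [norm_inv]
      by_cases htJ : t ∈ J
      · rw [Set.indicator_of_mem htJ]
        have h4 : ‖(t : ℂ) - z‖⁻¹ ≤ |z.im|⁻¹ :=
          inv_anti₀ (abs_pos.2 hz) (abs_im_le_norm_ofReal_sub z t)
        have h5 := pow_le_pow_left₀ (by positivity) h4 2
        have : 0 ≤ η := by positivity
        linarith
      · rw [Set.indicator_of_notMem htJ, zero_add]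
        have h4 : r < |t| := by
          by_contra hcon
          exact htJ (abs_le.1 (not_lt.1 hcon))
        have h5 : 2 * (‖V‖ + 1) ≤ ‖(t : ℂ) - z‖ := by
          have h6 := norm_sub_norm_le (t : ℂ) z
          rw [Complex.norm_real, Real.norm_eq_abs] at h6
          linarith
        exact pow_le_pow_left₀ (by positivity) (inv_anti₀ (by positivity) h5) 2
    have h4 : η * ‖V x‖ ^ 2 ≤ ‖x‖ ^ 2 / 4 := by
      have h5 : ‖V x‖ ≤ (‖V‖ + 1) * ‖x‖ :=
        (V.le_opNorm x).trans (mul_le_mul_of_nonneg_right (by linarith) (norm_nonneg _))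
      calc η * ‖V x‖ ^ 2 ≤ η * ((‖V‖ + 1) * ‖x‖) ^ 2 :=
            mul_le_mul_of_nonneg_left (pow_le_pow_left₀ (norm_nonneg _) h5 2) (by positivity)
        _ = ‖x‖ ^ 2 / 4 := by
            have : ‖V‖ + 1 ≠ 0 := by positivity
            rw [hη]
            field_simp
            ring
    rw [MeasureTheory.integral_add (hJi C₀) (integrable_const η), hJint,
      MeasureTheory.integral_const, Measure.real, Measure.real, hμ, E.scalarMeasure_univ,
      ENNReal.toReal_ofReal (by positivity), smul_eq_mul, mul_comm _ η] at h3
    exact h3.trans (add_le_add le_rfl h4)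
  rw [div_mul_eq_mul_div, le_div_iff₀ hden]
  nlinarith [mul_le_mul_of_nonneg_left h1 hC₀pos.le, mul_le_mul_of_nonneg_left h2 hδ.le]

theorem localSpectrum_subset_realSpectrum (hT : IsSelfAdjoint T) (V : K →L[ℂ] H) :
    localSpectrum V T ⊆ T.realSpectrum :=
  (T.spectralMeasure.compressedSupport_subset V).trans
    (spectralMeasure_spec hT).compressedSupport_id_subset

/-- Outside the union of the discs, `(T - z)⁻¹ V` is a strict contraction. -/
theorem exists_isResolvent_of_notMem_iUnion_closedBall (hT : IsSelfAdjoint T) {f : ℝ → ℝ}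
    (hf : f ∈ CPlus T.realSpectrum) (V : K →L[ℂ] H) {z : ℂ} (hz : z.im ≠ 0)
    (h : z ∉ ⋃ t ∈ localSpectrum V T,
      Metric.closedBall (t : ℂ) (‖(functionOf f T).comp V‖ / f t)) :
    ∃ R, T.IsResolvent z R ∧ ∃ q < 1, ∀ x, ‖R (V x)‖ ^ 2 ≤ q * ‖x‖ ^ 2 := by
  refine ⟨_, isResolvent_integral hT hz, exists_norm_resolvent_comp_lt_one hT hf V hz ?_⟩
  intro t ht
  simp only [Set.mem_iUnion, not_exists] at h
  have h1 := h t ht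
  have h2 : 0 < f t := hf.2.1 t (localSpectrum_subset_realSpectrum hT V ht)
  rw [Metric.mem_closedBall, not_le, dist_comm, dist_eq_norm, div_lt_iff₀ h2, mul_comm] at h1
  exact h1

end LinearPMap

end SpectralSupport

/-! ### The spectral inclusion -/

theorem theorem4p7 {H₁ H₂ : Type*}
    [NormedAddCommGroup H₁] [InnerProductSpace ℂ H₁] [CompleteSpace H₁]
    [NormedAddCommGroup H₂] [InnerProductSpace ℂ H₂] [CompleteSpace H₂]
    (A : H₁ →ₗ.[ℂ] H₁) (hA : IsSelfAdjoint A)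
    (D : H₂ →ₗ.[ℂ] H₂) (hD : IsSelfAdjoint D)
    (B : H₂ →L[ℂ] H₁)
    (f g : ℝ → ℝ) (hf : f ∈ CPlus A.realSpectrum) (hg : g ∈ CPlus D.realSpectrum) :
    (blockOperator A B (-ContinuousLinearMap.adjoint B) D).opSpectrum
        \ Set.range (Complex.ofReal : ℝ → ℂ) ⊆
      (⋃ t ∈ LinearPMap.localSpectrum B A,
        Metric.closedBall (t : ℂ) (‖(LinearPMap.functionOf f A).comp B‖ / f t)) ∩
      (⋃ s ∈ LinearPMap.localSpectrum (ContinuousLinearMap.adjoint B) D,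
        Metric.closedBall (s : ℂ)
          (‖(LinearPMap.functionOf g D).comp (ContinuousLinearMap.adjoint B)‖ / g s)) := by
  rintro z ⟨hzS, hzR⟩
  have hz : z.im ≠ 0 := fun h => hzR ⟨z.re, Complex.ext rfl h.symm⟩
  constructor
  · by_contra hcon
    obtain ⟨R, hR, q, hq, hRB⟩ :=
      LinearPMap.exists_isResolvent_of_notMem_iUnion_closedBall hA hf B hz hcon
    exact hzS (blockOperator_mem_resolventPoints_of_left hA hD B hz hR hq hRB)
  · by_contra hcon
    obtain ⟨R, hR, q, hq, hRB⟩ :=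
      LinearPMap.exists_isResolvent_of_notMem_iUnion_closedBall hD hg _ hz hcon
    exact hzS (blockOperator_mem_resolventPoints_of_right hA hD B hz hR hq hRB)
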